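/- Conventions. All graphs are simple. For a graph $G$ and a vertex $v$, $d_G(v)$ is the degree of $v$ and $B_r(G,v)$ is the subgraph of $G$ induced on the vertices at distance at most $r$ from $v$, rooted at $v$; $\cong$ denotes root-preserving isomorphism of rooted graphs. Let $\mathcal G_*$ be the space of connected locally finite rooted graphs up to $\cong$, with the distance $d_{loc}(G_1,G_2)=2^{-\sup\{r\,:\,B_r(G_1)\cong B_r(G_2)\}}$ (where $B_r(G_i)$ is the ball around the root of $G_i$) and its Borel $\sigma$-algebra. For finite non-empty $G$ and $H\in\mathcal G_*$ put $p_r(G,H)=|V(G)|^{-1}\,|\{v\in V(G): B_r(G,v)\cong H\}|$. Let $\mathrm{emb}(H,G)$ be the number of injective homomorphisms from $H$ to $G$ and, for a rooted graph $H'$, let $\mathrm{emb}'(H',G,v)$ be the number of those injective homomorphisms from $H'$ to $G$ that map the root of $H'$ to $v$. Statement. Let $h\ge 2$ be an integer. On a probability space, let $G_n$ $(n=1,2,\dots)$ be random finite non-empty graphs, write $n_1=n_1(n)=|V(G_n)|$ (possibly random), and let $v^*_n$ be a vertex chosen uniformly at random from $V(G_n)$ given $G_n$. Let $G^*$ be a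 random element of $\mathcal G_*$ with root $r^*$. Suppose that $\inf |V(G_n)|\to\infty$ as $n\to\infty$, where the (essential) infimum is over the probability space, and that $G_n$ converges to $G^*$ locally weakly in probability, i.e. for every integer $r\ge 0$ and every finite $H\in\mathcal G_*$, $$p_r(G_n,H)\xrightarrow{p}\mathbb P(B_r(G^*)\cong H).$$ Let $d^*=d_{G^*}(r^*)$, assume $\mathbb E (d^*)^{h-1}<\infty$, and let $d_n=d_{G_n}(v^*_n)$. Then the following statements are equivalent: (i) $\mathbb E\, d_n^{h-1}<\infty$ for all $n$, and $\mathbb E\, d_n^{h-1}\to\mathbb E (d^*)^{h-1}$; (ii) the sequence $d_n^{h-1}$ is uniformly integrable; (iii) for every connected graph $H$ on $h$ vertices and every rooted graph $H'$ obtained from $H$ by choosing one of its vertices as the root, the expectations $\mathbb E\big(n_1^{-1}\mathrm{emb}(H,G_n)\big)$ (for all $n$) and $\mathbb E\,\mathrm{emb}'(H',G^*,r^*)$ are finite, and $$\mathbb E\big(n_1^{-1}\,\mathrm{emb}(H,G_n)\big)\to\mathbb E\,\mathrm{emb}'(H',G^*,r^*).$$ Moreover, each of (i), (ii), (iii) implies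 that for every connected graph $H$ on $h$ vertices and every $H'$ obtained from $H$ by choosing a root, $\mathbb E\,\mathrm{emb}'(H',G^*,r^*)<\infty$ and $$n_1^{-1}\,\mathrm{emb}(H,G_n)\xrightarrow{p}\mathbb E\,\mathrm{emb}'(H',G^*,r^*).$$ -/

import Mathlib

open MeasureTheory Filter Topology

noncomputable section

namespace LocalWeak

/-- Root-preserving isomorphism of the rooted graphs `(G, v)` and `(H, w)`. -/
def RootedIso {V W : Type*} (G : SimpleGraph V) (v : V) (H : SimpleGraph W) (w : W) : Prop :=
  ∃ e : G ≃g H, e v = w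

/-- The vertices at graph distance at most `r` from `v`
(unreachable vertices are at distance `⊤`). -/
def ballSet {V : Type*} (G : SimpleGraph V) (v : V) (r : ℕ) : Set V :=
  {w | G.edist v w ≤ r}

/-- The graph of `B_r(G, v)`: the subgraph of `G` induced on the ball of radius `r` around `v`. -/
def ballGraph {V : Type*} (G : SimpleGraph V) (v : V) (r : ℕ) : SimpleGraph (ballSet G v r) :=
  G.induce (ballSet G v r)

/-- The root of `B_r(G, v)`. -/
def ballRoot {V : Type*} (G : SimpleGraph V) (v : V) (r : ℕ) : ballSet G v r :=
  ⟨v, by simp [ballSet]⟩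

/-- The degree of `v` in `G` (for a vertex with finitely many neighbours). -/
def deg {V : Type*} (G : SimpleGraph V) (v : V) : ℕ :=
  (G.neighborSet v).ncard

/-- `emb(H, G)`: the number of embeddings (injective homomorphisms) of `H` into `G`. -/
def emb {V W : Type*} (H : SimpleGraph W) (G : SimpleGraph V) : ℕ :=
  Nat.card (H.Copy G)

/-- `emb'(H', G, v)`, with `H'` the graph `H` rooted at `x`: the number of embeddings of `H` into
`G` that map `x` to `v`. (For `H` finite and connected and `G` locally finite there are finitely
many of them.) -/
def embRooted {V W : Type*} (H : SimpleGraph W) (x : W) (G : SimpleGraph V) (v : V) : ℕ :=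
  Nat.card {f : H.Copy G // f x = v}

/-! ### The space of rooted connected locally finite graphs -/

/-- A rooted connected locally finite graph. (Such a graph has countably many vertices, so vertex
types in `Type` give all isomorphism classes.) -/
structure RootedGraph where
  /-- the vertex type -/
  V : Type
  /-- the graph -/
  graph : SimpleGraph V
  /-- the root -/
  root : V
  connected : graph.Connected
  locallyFinite : ∀ v, (graph.neighborSet v).Finite

namespace RootedGraph

/-- `B_r(G₁) ≅ B_r(G₂)`. -/
def SameBall (r : ℕ) (G₁ G₂ : RootedGraph) : Prop :=
  RootedIso (ballGraph G₁.graph G₁.root r) (ballRoot G₁.graph G₁.root r)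
    (ballGraph G₂.graph G₂.root r) (ballRoot G₂.graph G₂.root r)

open Classical in
/-- `d_loc(G₁, G₂) = 2 ^ (- sup {r | B_r(G₁) ≅ B_r(G₂)})`, which is `0` if the supremum is
infinite. -/
def locDist (G₁ G₂ : RootedGraph) : ℝ :=
  if ∀ r, SameBall r G₁ G₂ then 0 else (1 / 2) ^ sSup {r : ℕ | SameBall r G₁ G₂}

theorem sameBall_refl (r : ℕ) (G : RootedGraph) : SameBall r G G :=
  ⟨SimpleGraph.Iso.refl, rfl⟩

theorem SameBall.symm {r : ℕ} {G₁ G₂ : RootedGraph} (h : SameBall r G₁ G₂) :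
    SameBall r G₂ G₁ := by
  obtain ⟨e, he⟩ := h
  exact ⟨e.symm, by rw [← he]; simp⟩

theorem SameBall.trans {r : ℕ} {G₁ G₂ G₃ : RootedGraph} (h : SameBall r G₁ G₂)
    (h' : SameBall r G₂ G₃) : SameBall r G₁ G₃ := by
  obtain ⟨e, he⟩ := h
  obtain ⟨e', he'⟩ := h'
  exact ⟨e.trans e', by rw [← he', ← he]; rfl⟩

theorem edist_le_of_iso {V W : Type*} {G : SimpleGraph V} {v : V} {H : SimpleGraph W} {w : W}
    {r : ℕ} (e : ballGraph G v r ≃g ballGraph H w r) (he : e (ballRoot G v r) = ballRoot H w r)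
    (k : ℕ) : ∀ x : ballSet G v r, G.edist v x ≤ k → H.edist w (e x) ≤ k := by
  induction k with
  | zero =>
    intro x hx
    have hx' : v = x.1 := by
      rw [← SimpleGraph.edist_eq_zero_iff (G := G)]
      exact nonpos_iff_eq_zero.mp (by exact_mod_cast hx)
    have : x = ballRoot G v r := Subtype.ext hx'.symm
    rw [this, he]
    simp [ballRoot]
  | succ k ih =>
    intro x hx
    by_cases hxv : v = x.1
    · have : x = ballRoot G v r := Subtype.ext hxv.symm
      rw [this, he]
      simp [ballRoot]
    have hne : G.edist x.1 v ≠ ⊤ := by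
      rw [SimpleGraph.edist_comm]
      exact ne_top_of_le_ne_top (ENat.natCast_ne_top _) hx
    obtain ⟨q, hq⟩ := SimpleGraph.exists_walk_of_edist_ne_top hne
    have key : ∀ {a b : V} (q : G.Walk a b), a ≠ b →
        ∃ y, G.Adj a y ∧ ∃ q' : G.Walk y b, q'.length + 1 = q.length := by
      intro a b q hab
      cases q with
      | nil => exact absurd rfl hab
      | cons hadj q => exact ⟨_, hadj, q, by simp⟩
    obtain ⟨y, hadj, q, hlq⟩ := key q (Ne.symm hxv)
    have hlen : ((q.length + 1 : ℕ) : ℕ∞) = G.edist v x := by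
      rw [SimpleGraph.edist_comm, ← hq, hlq]
    have hy : G.edist v y ≤ (q.length : ℕ∞) := by
      rw [SimpleGraph.edist_comm]; exact SimpleGraph.edist_le q
    have hqk : q.length ≤ k := by
      rw [← hlen] at hx
      have := (ENat.natCast_le_natCast.mp hx)
      omega
    have hqr : q.length ≤ r := by
      have h1 : G.edist v x ≤ r := x.2
      rw [← hlen] at h1
      have := (ENat.natCast_le_natCast.mp h1)
      omega
    let y' : ballSet G v r := ⟨y, hy.trans (by exact_mod_cast hqr)⟩
    have hyk : H.edist w (e y') ≤ k := ih y' (hy.trans (by exact_mod_cast hqk))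
    have hadj' : (ballGraph H w r).Adj (e y') (e x) := e.map_rel_iff.mpr hadj.symm
    have hadj'' : H.Adj (e y').1 (e x).1 := hadj'
    calc H.edist w (e x) ≤ H.edist w (e y') + H.edist (e y').1 (e x).1 :=
          SimpleGraph.edist_triangle
      _ ≤ k + 1 := add_le_add hyk (SimpleGraph.edist_eq_one_iff_adj.mpr hadj'').le
      _ = ((k + 1 : ℕ) : ℕ∞) := by push_cast; rfl

theorem SameBall.mono {r s : ℕ} {G₁ G₂ : RootedGraph} (h : SameBall r G₁ G₂) (hs : s ≤ r) :
    SameBall s G₁ G₂ := by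
  obtain ⟨e, he⟩ := h
  have he' : e.symm (ballRoot G₂.graph G₂.root r) = ballRoot G₁.graph G₁.root r := by
    rw [← he]; simp
  have hsr : ((s : ℕ) : ℕ∞) ≤ r := by exact_mod_cast hs
  let f : ballSet G₁.graph G₁.root s ≃ ballSet G₂.graph G₂.root s :=
    { toFun := fun x => ⟨e ⟨x.1, le_trans x.2 hsr⟩, edist_le_of_iso e he s _ x.2⟩
      invFun := fun x => ⟨e.symm ⟨x.1, le_trans x.2 hsr⟩, edist_le_of_iso e.symm he' s _ x.2⟩
      left_inv := fun x => by
        apply Subtype.ext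
        exact congrArg (fun z : ballSet G₁.graph G₁.root r => z.1)
          (e.symm_apply_apply ⟨x.1, le_trans x.2 hsr⟩)
      right_inv := fun x => by
        apply Subtype.ext
        exact congrArg (fun z : ballSet G₂.graph G₂.root r => z.1)
          (e.apply_symm_apply ⟨x.1, le_trans x.2 hsr⟩) }
  refine ⟨⟨f, ?_⟩, ?_⟩
  · intro x y
    exact e.map_rel_iff (a := ⟨x.1, le_trans x.2 hsr⟩) (b := ⟨y.1, le_trans y.2 hsr⟩)
  · apply Subtype.ext
    exact congrArg (fun z : ballSet G₂.graph G₂.root r => z.1) he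

theorem sameBall_zero (G₁ G₂ : RootedGraph) : SameBall 0 G₁ G₂ := by
  have key : ∀ (G : RootedGraph) (x : ballSet G.graph G.root 0), x.1 = G.root := fun G x => by
    have h : G.graph.edist G.root x ≤ ((0 : ℕ) : ℕ∞) := x.2
    have h' : G.graph.edist G.root x = 0 := nonpos_iff_eq_zero.mp (by exact_mod_cast h)
    exact (SimpleGraph.edist_eq_zero_iff.mp h').symm
  refine ⟨⟨⟨fun _ => ballRoot _ _ _, fun _ => ballRoot _ _ _, fun x => Subtype.ext (key G₁ x).symm,
    fun x => Subtype.ext (key G₂ x).symm⟩, ?_⟩, rfl⟩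
  intro x y
  have hx : x = y := Subtype.ext ((key G₁ x).trans (key G₁ y).symm)
  subst hx
  simp

theorem bddAbove_of_not_sameBall {k : ℕ} {G₁ G₂ : RootedGraph} (h : ¬ SameBall (k + 1) G₁ G₂) :
    k ∈ upperBounds {r : ℕ | SameBall r G₁ G₂} := fun r hr => by
  by_contra hk
  exact h (SameBall.mono hr (by omega))

theorem le_locDist {k : ℕ} {G₁ G₂ : RootedGraph} (h : ¬ SameBall (k + 1) G₁ G₂) :
    (1 / 2 : ℝ) ^ k ≤ locDist G₁ G₂ := by
  rw [locDist, if_neg (fun h' => h (h' _))]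
  exact pow_le_pow_of_le_one (by norm_num) (by norm_num)
    (csSup_le ⟨0, sameBall_zero G₁ G₂⟩ (bddAbove_of_not_sameBall h))

theorem locDist_cases (G₁ G₂ : RootedGraph) :
    locDist G₁ G₂ = 0 ∨ ∃ k, ¬ SameBall (k + 1) G₁ G₂ ∧ locDist G₁ G₂ = (1 / 2) ^ k := by
  by_cases h : ∀ r, SameBall r G₁ G₂
  · exact Or.inl (if_pos h)
  · refine Or.inr ⟨sSup {r : ℕ | SameBall r G₁ G₂}, fun h' => ?_, if_neg h⟩
    push Not at h
    obtain ⟨r, hr⟩ := h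
    have hb : BddAbove {r : ℕ | SameBall r G₁ G₂} :=
      ⟨r, bddAbove_of_not_sameBall (fun h'' => hr (h''.mono (by omega)))⟩
    have := le_csSup hb h'
    omega

theorem locDist_nonneg (G₁ G₂ : RootedGraph) : 0 ≤ locDist G₁ G₂ := by
  rw [locDist]; split_ifs <;> positivity

theorem locDist_comm (G₁ G₂ : RootedGraph) : locDist G₁ G₂ = locDist G₂ G₁ := by
  have h : ∀ r, SameBall r G₁ G₂ ↔ SameBall r G₂ G₁ := fun r => ⟨SameBall.symm, SameBall.symm⟩
  have h' : (fun r => SameBall r G₁ G₂) = fun r => SameBall r G₂ G₁ := funext fun r => propext (h r)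
  unfold locDist
  exact congrArg (fun p : ℕ → Prop =>
    open Classical in if ∀ r, p r then (0 : ℝ) else (1 / 2) ^ sSup {r : ℕ | p r}) h'

theorem locDist_triangle (G₁ G₂ G₃ : RootedGraph) :
    locDist G₁ G₃ ≤ locDist G₁ G₂ + locDist G₂ G₃ := by
  have h12 := locDist_nonneg G₁ G₂
  have h23 := locDist_nonneg G₂ G₃
  rcases locDist_cases G₁ G₃ with h | ⟨k, hk, h⟩
  · rw [h]; positivity
  · rw [h]
    by_cases h' : SameBall (k + 1) G₁ G₂
    · have := le_locDist (fun h'' => hk (h'.trans h''))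
      linarith
    · have := le_locDist h'
      linarith

/-- The local distance. Graphs are kept as representatives of their isomorphism classes, so this is
a pseudometric: its zero-distance classes are the isomorphism classes, and its open sets and Borel
sets are unions of isomorphism classes. -/
instance : PseudoMetricSpace RootedGraph where
  dist := locDist
  dist_self G := if_pos fun r => sameBall_refl r G
  dist_comm := locDist_comm
  dist_triangle := locDist_triangle

instance : MeasurableSpace RootedGraph := borel RootedGraph

instance : BorelSpace RootedGraph := ⟨rfl⟩

end RootedGraph

/-! ### Random finite graphs -/

/-- A finite non-empty graph, with vertex set `{0, …, size - 1}`. -/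
structure FinGraph where
  /-- the number of vertices -/
  size : ℕ
  size_pos : 0 < size
  /-- the graph -/
  graph : SimpleGraph (Fin size)

/-- The countable set of finite graphs is discrete. -/
instance : MeasurableSpace FinGraph := ⊤

/-- `p_r(G, H)`: the proportion of vertices `v` of `G` with `B_r(G, v) ≅ H`. -/
def ballFreq (r : ℕ) (G : FinGraph) (H : RootedGraph) : ℝ :=
  (Set.ncard {v : Fin G.size |
    RootedIso (ballGraph G.graph v r) (ballRoot G.graph v r) H.graph H.root} : ℝ) / G.size

/-- The random graphs `G n` converge locally weakly in probability to the random rooted graph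
`Gs`: `p_r(G n, H) → ℙ(B_r(Gs) ≅ H)` in probability for all `r` and all finite `H`. -/
def LocallyConvergesInProb {Ω : Type*} [MeasurableSpace Ω] (P : Measure Ω)
    (G : ℕ → Ω → FinGraph) (Gs : Ω → RootedGraph) : Prop :=
  ∀ (r : ℕ) (H : RootedGraph), Finite H.V →
    TendstoInMeasure P (fun n ω => ballFreq r (G n ω) H) atTop
      (fun _ => P.real {ω | RootedIso (ballGraph (Gs ω).graph (Gs ω).root r)
        (ballRoot (Gs ω).graph (Gs ω).root r) H.graph H.root})

/-- `v` is a uniformly random vertex of the random graph `G`: given `G = g`, each of the vertices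
of `g` is the value of `v` with probability `1 / |V(g)|`. -/
structure IsUniformVertex {Ω : Type*} [MeasurableSpace Ω] (P : Measure Ω)
    (G : Ω → FinGraph) (v : (ω : Ω) → Fin (G ω).size) : Prop where
  measurable : Measurable fun ω => (⟨G ω, v ω⟩ : Σ g : FinGraph, Fin g.size)
  uniform : ∀ (g : FinGraph) (i : Fin g.size),
    P {ω | (⟨G ω, v ω⟩ : Σ g : FinGraph, Fin g.size) = ⟨g, i⟩} = P {ω | G ω = g} / g.size

section Statements

variable {Ω : Type*} [MeasurableSpace Ω] (P : Measure Ω)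

/-- `𝔼 d_n ^ k → 𝔼 (d*) ^ k` (the moments `𝔼 d_n ^ k` being finite), where `d_n` is the degree of `v n`
in `G n` and `d*` is the degree of the root of `Gs`. -/
def DegreeMomentConverges (G : ℕ → Ω → FinGraph) (v : (n : ℕ) → (ω : Ω) → Fin (G n ω).size)
    (Gs : Ω → RootedGraph) (k : ℕ) : Prop :=
  (∀ n, Integrable (fun ω => (deg (G n ω).graph (v n ω) : ℝ) ^ k) P) ∧
  Tendsto (fun n => ∫ ω, (deg (G n ω).graph (v n ω) : ℝ) ^ k ∂P) atTop
    (𝓝 (∫ ω, (deg (Gs ω).graph (Gs ω).root : ℝ) ^ k ∂P))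

/-- The sequence `d_n ^ k` is uniformly integrable. -/
def DegreePowerUniformIntegrable (G : ℕ → Ω → FinGraph)
    (v : (n : ℕ) → (ω : Ω) → Fin (G n ω).size) (k : ℕ) : Prop :=
  UniformIntegrable (fun n ω => (deg (G n ω).graph (v n ω) : ℝ) ^ k) 1 P

/-- For every connected `H` on `h` vertices and every choice `x` of its root,
`𝔼 (|V(G n)|⁻¹ emb(H, G n)) → 𝔼 emb'((H, x), Gs)` (all these expectations being finite). -/
def MeanEmbConverges (G : ℕ → Ω → FinGraph) (Gs : Ω → RootedGraph) (h : ℕ) : Prop :=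
  ∀ (H : SimpleGraph (Fin h)) (x : Fin h), H.Connected →
    (∀ n, Integrable (fun ω => ((G n ω).size : ℝ)⁻¹ * (emb H (G n ω).graph : ℝ)) P) ∧
    Integrable (fun ω => (embRooted H x (Gs ω).graph (Gs ω).root : ℝ)) P ∧
    Tendsto (fun n => ∫ ω, ((G n ω).size : ℝ)⁻¹ * (emb H (G n ω).graph : ℝ) ∂P) atTop
      (𝓝 (∫ ω, (embRooted H x (Gs ω).graph (Gs ω).root : ℝ) ∂P))

/-- For every connected `H` on `h` vertices and every choice `x` of its root,
`|V(G n)|⁻¹ emb(H, G n) → 𝔼 emb'((H, x), Gs)` in probability (the limit being finite). -/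
def EmbConvergesInProb (G : ℕ → Ω → FinGraph) (Gs : Ω → RootedGraph) (h : ℕ) : Prop :=
  ∀ (H : SimpleGraph (Fin h)) (x : Fin h), H.Connected →
    Integrable (fun ω => (embRooted H x (Gs ω).graph (Gs ω).root : ℝ)) P ∧
    TendstoInMeasure P (fun n ω => ((G n ω).size : ℝ)⁻¹ * (emb H (G n ω).graph : ℝ)) atTop
      (fun _ => ∫ ω, (embRooted H x (Gs ω).graph (Gs ω).root : ℝ) ∂P)

end Statements

end LocalWeak

end

open MeasureTheory Filter Topology

noncomputable section

namespace LocalWeak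

/-! ### Balls in locally finite graphs -/

/-! Every condition is compared with a single one, `SmallTails`: the vertices of degree more than
`M` contribute little to the mean of `d ^ (h - 1)`, uniformly in `n`.

Bounded local functions. There are countably many isomorphism classes of `r`-balls, and their
frequencies in `G n` and probabilities in the limit both sum to 1. A Scheffé argument therefore
turns convergence in probability of each frequency into L¹ convergence of the vertex average of any
bounded function of the `r`-ball (`tendsto_integral_abs_vertexAvg_sub`). Cutting `d ^ (h - 1)` at
level `M` leaves a bounded local part, whose mean converges, and a tail; hence the means converge if
and only if the tails are uniformly small.

From tails to embeddings. Following a spanning tree of `H` from its root, at most `D ^ (h - 1)`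
embeddings with a given root image use only vertices of degree at most `D`. Such a truncated count
is bounded and local. An embedding using a larger degree is rerooted at a vertex whose image has
maximal degree `d`, so these embeddings number at most `h * ∑ d ^ (h - 1)` over vertices with `d >
D` (`emb_le_sum_embTrunc_add`). Small tails thus give L¹ convergence of the normalized counts, which
yields both (iii) and convergence in probability.

From embeddings to tails. For a star rooted at its centre the count is a falling factorial of the
degree, and this is comparable with `d ^ (h - 1)` for large `d`. -/

theorem exists_adj_edist_le {V : Type*} {G : SimpleGraph V} {v x : V} {k : ℕ}
    (hx : G.edist v x ≤ (k + 1 : ℕ)) (hne : v ≠ x) : ∃ y, G.Adj y x ∧ G.edist v y ≤ k := by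
  have hfin : G.edist x v ≠ ⊤ := by
    rw [SimpleGraph.edist_comm]
    exact ne_top_of_le_ne_top (ENat.natCast_ne_top _) hx
  obtain ⟨q, hq⟩ := SimpleGraph.exists_walk_of_edist_ne_top hfin
  rw [SimpleGraph.edist_comm, ← hq] at hx
  cases q with
  | nil => exact absurd rfl hne
  | cons hadj q =>
    refine ⟨_, hadj.symm, ?_⟩
    rw [SimpleGraph.edist_comm]
    refine (SimpleGraph.edist_le q).trans ?_
    have := ENat.natCast_le_natCast.mp hx
    simp only [SimpleGraph.Walk.length_cons] at this
    exact_mod_cast (by omega : q.length ≤ k)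

theorem edist_le_succ_of_adj {V : Type*} {G : SimpleGraph V} {v x y : V} {k : ℕ}
    (hx : G.edist v x ≤ k) (hadj : G.Adj x y) : G.edist v y ≤ (k + 1 : ℕ) :=
  calc G.edist v y ≤ G.edist v x + G.edist x y := SimpleGraph.edist_triangle
    _ ≤ k + 1 := add_le_add hx (SimpleGraph.edist_eq_one_iff_adj.mpr hadj).le
    _ = ((k + 1 : ℕ) : ℕ∞) := by push_cast; rfl

theorem ballSet_finite {V : Type*} {G : SimpleGraph V} (hG : ∀ v, (G.neighborSet v).Finite)
    (v : V) (r : ℕ) : (ballSet G v r).Finite := by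
  induction r with
  | zero =>
    refine (Set.finite_singleton v).subset fun x hx => ?_
    simpa [ballSet] using hx
  | succ r ih =>
    refine ((ih.biUnion fun y _ => hG y).union (Set.finite_singleton v)).subset fun x hx => ?_
    by_cases hne : v = x
    · exact Or.inr hne.symm
    · obtain ⟨y, hadj, hy⟩ := exists_adj_edist_le hx hne
      exact Or.inl (Set.mem_biUnion (x := y) hy hadj)

/-- A geodesic from the root to a point of the ball never leaves the ball. -/
theorem ballGraph_connected {V : Type*} (G : SimpleGraph V) (v : V) (r : ℕ) :
    (ballGraph G v r).Connected := by
  have key : ∀ (k : ℕ) (x : ballSet G v r), G.edist v x ≤ k →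
      (ballGraph G v r).Reachable (ballRoot G v r) x := by
    intro k
    induction k with
    | zero =>
      intro x hx
      have : G.edist v x = 0 := by simpa using hx
      have : ballRoot G v r = x := Subtype.ext (SimpleGraph.edist_eq_zero_iff.mp this)
      rw [this]
    | succ k ih =>
      intro x hx
      by_cases hk : G.edist v x ≤ k
      · exact ih x hk
      by_cases hne : v = x
      · rw [show ballRoot G v r = x from Subtype.ext hne]
      obtain ⟨y, hadj, hy⟩ := exists_adj_edist_le hx hne
      have hkr : (k : ℕ∞) ≤ r := by
        by_contra hkr
        have h1 : (r : ℕ∞) ≤ k := (not_le.mp hkr).le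
        exact hk (le_trans x.2 h1)
      let y' : ballSet G v r := ⟨y, hy.trans hkr⟩
      have hadj' : (ballGraph G v r).Adj y' x := hadj
      exact (ih y' hy).trans hadj'.reachable
  rw [SimpleGraph.connected_iff_exists_forall_reachable]
  exact ⟨ballRoot G v r, fun x => key r x x.2⟩

/-- A vertex at depth at most `r - 1` has all its neighbours inside the ball, so the isomorphism
injects one neighbourhood into the other. -/
theorem deg_le_of_ballIso {V W : Type*} {G : SimpleGraph V} {v : V} {H : SimpleGraph W} {w : W}
    {r k : ℕ} (hH : ∀ u, (H.neighborSet u).Finite)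
    (e : ballGraph G v r ≃g ballGraph H w r) (hkr : k + 1 ≤ r) (u : ballSet G v r)
    (hu : G.edist v u ≤ k) : deg G u ≤ deg H (e u) := by
  have hkr' : ((k + 1 : ℕ) : ℕ∞) ≤ r := by exact_mod_cast hkr
  have hmem : ∀ y ∈ G.neighborSet u, y ∈ ballSet G v r := fun y hy =>
    (edist_le_succ_of_adj hu hy).trans hkr'
  refine Set.ncard_le_ncard_of_injOn
    -- The value `w` outside the ball is a dummy: no neighbour of `u` lies there.
    (fun y => open Classical in if hy : y ∈ ballSet G v r then (e ⟨y, hy⟩ : W) else w) ?_ ?_ (hH _)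
  · intro y hy
    have hadj : (ballGraph H w r).Adj (e u) (e ⟨y, hmem y hy⟩) :=
      e.map_rel_iff.mpr (show (ballGraph G v r).Adj u ⟨y, hmem y hy⟩ from hy)
    simp only [hmem y hy, dif_pos]
    exact hadj
  · intro y hy z hz hyz
    simp only [hmem y hy, hmem z hz, dif_pos] at hyz
    exact congrArg Subtype.val (e.injective (Subtype.ext hyz))

theorem deg_eq_of_ballIso {V W : Type*} {G : SimpleGraph V} {v : V} {H : SimpleGraph W} {w : W}
    {r k : ℕ} (hG : ∀ u, (G.neighborSet u).Finite) (hH : ∀ u, (H.neighborSet u).Finite)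
    (e : ballGraph G v r ≃g ballGraph H w r) (he : e (ballRoot G v r) = ballRoot H w r)
    (hkr : k + 1 ≤ r) (u : ballSet G v r) (hu : G.edist v u ≤ k) : deg G u = deg H (e u) := by
  refine le_antisymm (deg_le_of_ballIso hH e hkr u hu) ?_
  have := deg_le_of_ballIso hG e.symm hkr (e u) (RootedGraph.edist_le_of_iso e he k u hu)
  rwa [e.symm_apply_apply] at this

/-! ### Counting embeddings in terms of degrees -/

theorem exists_neighbor_index {V : Type*} {G : SimpleGraph V}
    (hG : ∀ v, (G.neighborSet v).Finite) :
    ∃ idx : V → V → ℕ, (∀ u w, G.Adj u w → idx u w < deg G u) ∧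
      ∀ u w w', G.Adj u w → G.Adj u w' → idx u w = idx u w' → w = w' := by
  have : ∀ u, ∃ f : V → ℕ, (∀ w, G.Adj u w → f w < deg G u) ∧
      ∀ w w', G.Adj u w → G.Adj u w' → f w = f w' → w = w' := by
    intro u
    have := (hG u).to_subtype
    have e : G.neighborSet u ≃ Fin (deg G u) := Finite.equivFin _
    classical
    refine ⟨fun w => if hw : G.Adj u w then e ⟨w, hw⟩ else 0, fun w hw => ?_,
      fun w w' hw hw' h => ?_⟩
    · simp only [hw, dif_pos]; exact (e ⟨w, hw⟩).2
    · simp only [hw, hw', dif_pos] at h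
      exact congrArg Subtype.val (e.injective (Fin.ext h))
  choose f h1 h2 using this
  exact ⟨f, h1, h2⟩

/-- The embeddings of `H` into `G` that map `x` to `v` and use only vertices of degree at most
`D`. -/
abbrev TruncCopy {V W : Type*} (H : SimpleGraph W) (x : W) (G : SimpleGraph V) (v : V) (D : ℕ) :=
  {f : H.Copy G // f x = v ∧ ∀ y, deg G (f y) ≤ D}

/-- The map `p` is the parent map of a breadth-first spanning tree rooted at `x`. -/
theorem exists_parent {W : Type*} {H : SimpleGraph W} (hH : H.Connected) (x : W) :
    ∃ p : W → W, ∀ y, y ≠ x → H.Adj (p y) y ∧ H.dist x (p y) < H.dist x y := by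
  have : ∀ y, ∃ z, y ≠ x → H.Adj z y ∧ H.dist x z < H.dist x y := by
    intro y
    by_cases hy : y = x
    · exact ⟨x, fun h => absurd hy h⟩
    have hpos : 0 < H.dist x y := hH.pos_dist_of_ne (Ne.symm hy)
    obtain ⟨k, hk⟩ : ∃ k, H.dist x y = k + 1 := ⟨H.dist x y - 1, by omega⟩
    have hle : H.edist x y ≤ (k + 1 : ℕ) := by
      rw [← hk, (hH x y).coe_dist_eq_edist]
    obtain ⟨z, hadj, hz⟩ := exists_adj_edist_le hle (Ne.symm hy)
    refine ⟨z, fun _ => ⟨hadj, ?_⟩⟩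
    rw [← (hH x z).coe_dist_eq_edist] at hz
    have := ENat.natCast_le_natCast.mp hz
    omega
  choose p hp using this
  exact ⟨p, hp⟩

/-- An embedding is encoded by the position of the image of each non-root vertex among the
neighbours of the image of its parent, a number below `D`. Decoding goes outwards from `x`, by
induction on the distance. With `h` vertices this leaves at most `D ^ (h - 1)` codes. -/
theorem exists_truncCopy_injection {V W : Type*} {H : SimpleGraph W} (hH : H.Connected) (x : W)
    {G : SimpleGraph V} (hG : ∀ v, (G.neighborSet v).Finite) (v : V) (D : ℕ) :
    ∃ c : TruncCopy H x G v D → ({y : W // y ≠ x} → Fin D), Function.Injective c := by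
  obtain ⟨idx, h1, h2⟩ := exists_neighbor_index hG
  obtain ⟨p, hp⟩ := exists_parent hH x
  have hadj : ∀ (f : H.Copy G) y, y ≠ x → G.Adj (f (p y)) (f y) := fun f y hy =>
    f.toHom.map_rel (hp y hy).1
  refine ⟨fun f y => ⟨idx (f.1 (p y)) (f.1 y),
    (h1 _ _ (hadj f.1 y y.2)).trans_le (f.2.2 _)⟩, fun f g hfg => ?_⟩
  have key : ∀ (n : ℕ) (y : W), H.dist x y = n → f.1 y = g.1 y := by
    intro n
    induction n using Nat.strong_induction_on with
    | _ n ih =>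
      intro y hy
      by_cases hyx : y = x
      · rw [hyx, f.2.1, g.2.1]
      have hpar := ih _ (hy ▸ (hp y hyx).2) (p y) rfl
      have hi := congrArg Fin.val (congrFun hfg ⟨y, hyx⟩)
      simp only at hi
      rw [← hpar] at hi
      exact h2 _ _ _ (hadj f.1 y hyx) (hpar ▸ hadj g.1 y hyx) hi
  exact Subtype.ext (SimpleGraph.Copy.ext fun y => key _ y rfl)

theorem finite_truncCopy {V W : Type*} [Finite W] {H : SimpleGraph W} (hH : H.Connected) (x : W)
    {G : SimpleGraph V} (hG : ∀ v, (G.neighborSet v).Finite) (v : V) (D : ℕ) :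
    Finite (TruncCopy H x G v D) :=
  let ⟨_, hc⟩ := exists_truncCopy_injection hH x hG v D
  Finite.of_injective _ hc

theorem card_truncCopy_le {V : Type*} {h : ℕ} {H : SimpleGraph (Fin h)} (hH : H.Connected)
    (x : Fin h) {G : SimpleGraph V} (hG : ∀ v, (G.neighborSet v).Finite) (v : V) (D : ℕ) :
    Nat.card (TruncCopy H x G v D) ≤ D ^ (h - 1) := by
  obtain ⟨c, hc⟩ := exists_truncCopy_injection hH x hG v D
  refine (Nat.card_le_card_of_injective c hc).trans (le_of_eq ?_)
  rw [Nat.card_eq_fintype_card]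
  simp

theorem edist_copy_le {V W : Type*} {H : SimpleGraph W} (hH : H.Connected) {G : SimpleGraph V}
    (f : H.Copy G) (x y : W) : G.edist (f x) (f y) ≤ H.dist x y := by
  obtain ⟨p, hp⟩ := hH.exists_walk_length_eq_dist x y
  rw [← hp]
  exact (SimpleGraph.edist_le (p.map f.toHom)).trans (by simp)

theorem dist_lt_card {h : ℕ} {H : SimpleGraph (Fin h)} (hH : H.Connected) (x y : Fin h) :
    H.dist x y < h := by
  obtain ⟨p, hp, hl⟩ := hH.exists_path_of_dist x y
  rw [← hl]
  simpa using hp.length_lt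

theorem copy_mem_ballSet {V : Type*} {h : ℕ} {H : SimpleGraph (Fin h)} (hH : H.Connected)
    {x : Fin h} {G : SimpleGraph V} {v : V} (f : H.Copy G) (hf : f x = v) (y : Fin h) :
    f y ∈ ballSet G v h := by
  have := edist_copy_le hH f x y
  rw [hf] at this
  exact this.trans (by exact_mod_cast (dist_lt_card hH x y).le)

theorem exists_deg_bound {V : Type*} {h : ℕ} {H : SimpleGraph (Fin h)} (hH : H.Connected)
    (x : Fin h) {G : SimpleGraph V} (hG : ∀ v, (G.neighborSet v).Finite) (v : V) :
    ∃ D, ∀ f : H.Copy G, f x = v → ∀ y, deg G (f y) ≤ D := by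
  obtain ⟨D, hD⟩ := ((ballSet_finite hG v h).image (deg G)).bddAbove
  exact ⟨D, fun f hf y => hD ⟨_, copy_mem_ballSet hH f hf y, rfl⟩⟩

theorem finite_rootedCopy {V : Type*} {h : ℕ} {H : SimpleGraph (Fin h)} (hH : H.Connected)
    (x : Fin h) {G : SimpleGraph V} (hG : ∀ v, (G.neighborSet v).Finite) (v : V) :
    Finite {f : H.Copy G // f x = v} := by
  obtain ⟨D, hD⟩ := exists_deg_bound hH x hG v
  have := finite_truncCopy hH x hG v D
  exact Finite.of_injective
    (fun f : {f : H.Copy G // f x = v} => (⟨f.1, f.2, hD f.1 f.2⟩ : TruncCopy H x G v D))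
    fun f g hfg => Subtype.ext (congrArg (fun z : TruncCopy H x G v D => z.1) hfg)

/-- The number of embeddings of `H` into `G` that map `x` to `v` and use only vertices of degree at
most `D`. -/
def embTrunc {V W : Type*} (H : SimpleGraph W) (x : W) (D : ℕ) (G : SimpleGraph V) (v : V) : ℕ :=
  Nat.card (TruncCopy H x G v D)

theorem embTrunc_mono {V W : Type*} [Finite W] {H : SimpleGraph W} (hH : H.Connected) (x : W)
    {G : SimpleGraph V} (hG : ∀ v, (G.neighborSet v).Finite) (v : V) :
    Monotone fun D => embTrunc H x D G v := by
  intro D D' hDD'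
  have := finite_truncCopy hH x hG v D'
  exact Nat.card_le_card_of_injective
    (fun f : TruncCopy H x G v D =>
      (⟨f.1, f.2.1, fun y => (f.2.2 y).trans hDD'⟩ : TruncCopy H x G v D'))
    fun f g hfg => Subtype.ext (congrArg (fun z : TruncCopy H x G v D' => z.1) hfg)

/-- All embeddings rooted at `v` stay in one finite ball, where the degrees are bounded. -/
theorem embTrunc_eventually_eq {V : Type*} {h : ℕ} {H : SimpleGraph (Fin h)} (hH : H.Connected)
    (x : Fin h) {G : SimpleGraph V} (hG : ∀ v, (G.neighborSet v).Finite) (v : V) :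
    ∀ᶠ D in atTop, embTrunc H x D G v = embRooted H x G v := by
  obtain ⟨D, hD⟩ := exists_deg_bound hH x hG v
  filter_upwards [eventually_ge_atTop D] with D' hD'
  exact Nat.card_congr (Equiv.subtypeEquivRight fun f =>
    ⟨fun hf => hf.1, fun hf => ⟨hf, fun y => (hD f hf y).trans hD'⟩⟩)

theorem embTrunc_le_embRooted {V : Type*} {h : ℕ} {H : SimpleGraph (Fin h)} (hH : H.Connected)
    (x : Fin h) {G : SimpleGraph V} (hG : ∀ v, (G.neighborSet v).Finite) (D : ℕ) (v : V) :
    embTrunc H x D G v ≤ embRooted H x G v := by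
  have := finite_rootedCopy hH x hG v
  exact Nat.card_le_card_of_injective
    (fun f : TruncCopy H x G v D => (⟨f.1, f.2.1⟩ : {f : H.Copy G // f x = v}))
    fun f g hfg => Subtype.ext (congrArg (fun z : {f : H.Copy G // f x = v} => z.1) hfg)

/-- Images lie within distance `h` of the root; the radius is `h + 1` because the degree bound on
them must be visible too. -/
theorem embTrunc_le_of_ballIso {V W : Type*} {h : ℕ} {K : SimpleGraph (Fin h)}
    (hK : K.Connected) (x : Fin h) (D : ℕ) {G : SimpleGraph V} {v : V} {H : SimpleGraph W} {w : W}
    (hG : ∀ u, (G.neighborSet u).Finite) (hH : ∀ u, (H.neighborSet u).Finite)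
    (e : ballGraph G v (h + 1) ≃g ballGraph H w (h + 1))
    (he : e (ballRoot G v (h + 1)) = ballRoot H w (h + 1)) :
    embTrunc K x D G v ≤ embTrunc K x D H w := by
  have hmem : ∀ (f : K.Copy G), f x = v → ∀ y, f y ∈ ballSet G v (h + 1) := fun f hf y =>
    le_trans (show G.edist v (f y) ≤ h from copy_mem_ballSet hK f hf y)
      (by exact_mod_cast Nat.le_succ h)
  have := finite_truncCopy hK x hH w D
  let φ : TruncCopy K x G v D → TruncCopy K x H w D := fun f =>
    ⟨⟨⟨fun y => (e ⟨f.1 y, hmem f.1 f.2.1 y⟩ : W), fun {a b} hab =>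
        (e.map_rel_iff (a := ⟨f.1 a, hmem f.1 f.2.1 a⟩) (b := ⟨f.1 b, hmem f.1 f.2.1 b⟩)).mpr
          (f.1.toHom.map_rel hab)⟩,
      fun a b hab => f.1.injective (congrArg Subtype.val (e.injective (Subtype.ext hab)))⟩, by
      have hroot : (⟨f.1 x, hmem f.1 f.2.1 x⟩ : ballSet G v (h + 1)) = ballRoot G v (h + 1) :=
        Subtype.ext f.2.1
      have hval := congrArg Subtype.val ((congrArg e hroot).trans he)
      refine ⟨hval, fun y => ?_⟩
      have hdeg := deg_eq_of_ballIso hG hH e he le_rfl ⟨f.1 y, hmem f.1 f.2.1 y⟩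
        (copy_mem_ballSet hK f.1 f.2.1 y)
      exact hdeg.symm.le.trans (f.2.2 y)⟩
  refine Nat.card_le_card_of_injective φ fun f g hfg => ?_
  refine Subtype.ext (SimpleGraph.Copy.ext fun y => ?_)
  have hy : ((φ f).1 y : W) = (φ g).1 y := by rw [hfg]
  exact congrArg Subtype.val (e.injective (Subtype.ext hy))

theorem embTrunc_eq_of_ballIso {V W : Type*} {h : ℕ} {K : SimpleGraph (Fin h)}
    (hK : K.Connected) (x : Fin h) (D : ℕ) {G : SimpleGraph V} {v : V} {H : SimpleGraph W} {w : W}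
    (hG : ∀ u, (G.neighborSet u).Finite) (hH : ∀ u, (H.neighborSet u).Finite)
    (hiso : RootedIso (ballGraph G v (h + 1)) (ballRoot G v (h + 1))
      (ballGraph H w (h + 1)) (ballRoot H w (h + 1))) :
    embTrunc K x D G v = embTrunc K x D H w := by
  obtain ⟨e, he⟩ := hiso
  exact le_antisymm (embTrunc_le_of_ballIso hK x D hG hH e he)
    (embTrunc_le_of_ballIso hK x D hH hG e.symm (by rw [← he, e.symm_apply_apply]))

/-! ### Embeddings into finite graphs -/

/-- Embeddings are sorted by the image of `x`. This makes the normalized count a vertex average,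
whichever root is chosen. -/
theorem emb_eq_sum_embRooted {V W : Type*} [Finite W] [Fintype V] (H : SimpleGraph W) (x : W)
    (G : SimpleGraph V) : emb H G = ∑ v, embRooted H x G v := by
  have : Finite (H.Copy G) := Finite.of_injective (fun f : H.Copy G => (f : W → V))
    DFunLike.coe_injective
  rw [emb, Nat.card_congr (Equiv.sigmaFiberEquiv fun f : H.Copy G => f x).symm, Nat.card_sigma]
  rfl

/-- Rooting an embedding at a vertex whose image has maximal degree bounds the number of embeddings
that use a vertex of degree more than `D`. -/
theorem emb_le_sum_embTrunc_add {V : Type*} [Fintype V] {h : ℕ} {H : SimpleGraph (Fin h)}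
    (hH : H.Connected) (x : Fin h) (G : SimpleGraph V) (D : ℕ) :
    emb H G ≤ ∑ v, embTrunc H x D G v +
      h * ∑ v, (if D < deg G v then deg G v ^ (h - 1) else 0) := by
  have hG : ∀ v, (G.neighborSet v).Finite := fun v => Set.toFinite _
  have hfin : Finite (H.Copy G) := Finite.of_injective (fun f : H.Copy G => (f : Fin h → V))
    DFunLike.coe_injective
  have : Nonempty (Fin h) := ⟨x⟩
  have hmax : ∀ f : H.Copy G, ∃ y, ∀ z, deg G (f z) ≤ deg G (f y) := fun f =>
    Finite.exists_max fun z => deg G (f z)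
  choose m hm using hmax
  let T := (Σ v, TruncCopy H x G v D) ⊕
    (Σ y : Fin h, Σ v : {v : V // D < deg G v}, TruncCopy H y G v (deg G v))
  have : ∀ (y : Fin h) v D, Finite (TruncCopy H y G v D) := fun y v D =>
    finite_truncCopy hH y hG v D
  classical
  -- When some degree exceeds `D`, the embedding is recorded at the vertex `m f` of largest image
  -- degree. The truncation level there is that degree itself, so it excludes nothing and the
  -- spanning-tree bound gives `deg ^ (h - 1)`.
  let φ : H.Copy G → T := fun f =>
    if hf : ∀ y, deg G (f y) ≤ D then Sum.inl ⟨f x, f, rfl, hf⟩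
    else Sum.inr ⟨m f, ⟨f (m f), by
      push Not at hf
      obtain ⟨y, hy⟩ := hf
      exact hy.trans_le (hm f y)⟩, f, rfl, hm f⟩
  have hφ : Function.Injective φ := by
    let ψ : T → H.Copy G := Sum.elim (fun t => t.2.1) (fun t => t.2.2.1)
    refine Function.LeftInverse.injective (g := ψ) fun f => ?_
    by_cases hf : ∀ y, deg G (f y) ≤ D
    · simp only [φ, dif_pos hf]; rfl
    · simp only [φ, dif_neg hf]; rfl
  refine (Nat.card_le_card_of_injective φ hφ).trans ?_
  rw [Nat.card_sum, Nat.card_sigma, Nat.card_sigma]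
  refine add_le_add le_rfl ?_
  calc ∑ y : Fin h, Nat.card (Σ v : {v : V // D < deg G v}, TruncCopy H y G v (deg G v))
      ≤ ∑ y : Fin h, ∑ v, (if D < deg G v then deg G v ^ (h - 1) else 0) := by
        refine Finset.sum_le_sum fun y _ => ?_
        rw [Nat.card_sigma, ← Finset.sum_filter, Finset.sum_subtype (p := fun v => D < deg G v)
          (Finset.univ.filter fun v => D < deg G v) (by simp)]
        exact Finset.sum_le_sum fun v _ => card_truncCopy_le hH y hG v _
    _ = _ := by simp

/-! ### Stars -/

/-- Once the centre is sent to `v`, an embedding is an injection of the `k` leaves into the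
neighbours of `v`. -/
theorem embRooted_starGraph {V : Type*} {G : SimpleGraph V} (hG : ∀ v, (G.neighborSet v).Finite)
    (k : ℕ) (v : V) :
    embRooted (SimpleGraph.starGraph (0 : Fin (k + 1))) 0 G v = (deg G v).descFactorial k := by
  have := (hG v).fintype
  have hcard : (deg G v).descFactorial k = Nat.card (Fin k ↪ G.neighborSet v) := by
    rw [Nat.card_eq_fintype_card, Fintype.card_embedding_eq, Fintype.card_fin, deg,
      Set.ncard_eq_toFinset_card', Set.toFinset_card]
  rw [hcard]
  refine Nat.card_congr
    { toFun := fun f => ⟨fun i => ⟨f.1 i.succ, by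
          have hadj : (SimpleGraph.starGraph (0 : Fin (k + 1))).Adj 0 i.succ := by
            simp [(Fin.succ_ne_zero i).symm]
          have hadj' : G.Adj (f.1 0) (f.1 i.succ) := f.1.toHom.map_rel hadj
          rwa [f.2] at hadj'⟩, fun i j hij => by
            have := f.1.injective (congrArg Subtype.val hij)
            exact Fin.succ_injective _ this⟩
      invFun := fun g => ⟨⟨⟨Fin.cons v fun i => (g i : V), ?_⟩, ?_⟩, rfl⟩
      left_inv := ?_
      right_inv := ?_ }
  · intro a b hab
    rw [SimpleGraph.starGraph_adj] at hab
    obtain ⟨hne, rfl | rfl⟩ := hab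
    · obtain ⟨j, rfl⟩ := Fin.exists_succ_eq.mpr hne.symm
      exact (g j).2
    · obtain ⟨j, rfl⟩ := Fin.exists_succ_eq.mpr hne
      exact (g j).2.symm
  · refine Fin.cons_injective_iff.mpr ⟨?_, fun i j hij => g.injective (Subtype.ext hij)⟩
    rintro ⟨i, hi⟩
    exact G.loopless.irrefl v (by simpa [hi] using (g i).2)
  · intro f
    refine Subtype.ext (SimpleGraph.Copy.ext fun y => ?_)
    refine Fin.cases ?_ (fun i => ?_) y
    · exact f.2.symm
    · rfl
  · intro g
    ext i
    rfl

/-! ### Local functions of pointed graphs -/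

/-- A locally finite graph, not necessarily connected, with a distinguished vertex. -/
structure PointedGraph where
  /-- the vertex type -/
  V : Type
  /-- the graph -/
  graph : SimpleGraph V
  /-- the distinguished vertex -/
  root : V
  locallyFinite : ∀ v, (graph.neighborSet v).Finite

/-- A rooted connected graph as a pointed graph. -/
def RootedGraph.pointed (G : RootedGraph) : PointedGraph :=
  ⟨G.V, G.graph, G.root, G.locallyFinite⟩

/-- The finite graph `g` pointed at `i`. -/
def FinGraph.pointed (g : FinGraph) (i : Fin g.size) : PointedGraph :=
  ⟨Fin g.size, g.graph, i, fun _ => Set.toFinite _⟩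

/-- A function of pointed graphs that depends only on the ball of radius `r`. -/
def IsLocal {α : Type*} (r : ℕ) (F : PointedGraph → α) : Prop :=
  ∀ X Y : PointedGraph, RootedIso (ballGraph X.graph X.root r) (ballRoot X.graph X.root r)
    (ballGraph Y.graph Y.root r) (ballRoot Y.graph Y.root r) → F X = F Y

theorem RootedIso.symm {V W : Type*} {G : SimpleGraph V} {v : V} {H : SimpleGraph W} {w : W}
    (h : RootedIso G v H w) : RootedIso H w G v := by
  obtain ⟨e, he⟩ := h
  exact ⟨e.symm, by rw [← he, e.symm_apply_apply]⟩

theorem RootedIso.trans {V W U : Type*} {G : SimpleGraph V} {v : V} {H : SimpleGraph W} {w : W}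
    {K : SimpleGraph U} {u : U} (h : RootedIso G v H w) (h' : RootedIso H w K u) :
    RootedIso G v K u := by
  obtain ⟨e, he⟩ := h
  obtain ⟨e', he'⟩ := h'
  exact ⟨e.trans e', by rw [← he', ← he]; rfl⟩

theorem IsLocal.comp {α β : Type*} {r : ℕ} {F : PointedGraph → α} (hF : IsLocal r F)
    (φ : α → β) : IsLocal r fun X => φ (F X) :=
  fun X Y h => congrArg φ (hF X Y h)

/-- Distance below `(1 / 2) ^ r` forces equal balls of radius `r + 1`, so a local function is
locally constant and every preimage is open. -/
theorem IsLocal.measurable {α : Type*} [MeasurableSpace α] {r : ℕ} {F : PointedGraph → α}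
    (hF : IsLocal r F) : Measurable fun G : RootedGraph => F G.pointed := by
  refine fun s _ => IsOpen.measurableSet (Metric.isOpen_iff.mpr fun G₁ hG₁ => ?_)
  refine ⟨(1 / 2) ^ r, by positivity, fun G₂ hG₂ => ?_⟩
  have hball : RootedGraph.SameBall (r + 1) G₂ G₁ := by
    by_contra hne
    exact absurd (RootedGraph.le_locDist hne) (not_le.mpr hG₂)
  have := hF G₂.pointed G₁.pointed (hball.mono (Nat.le_succ r))
  simpa only [Set.mem_preimage, this] using hG₁

theorem isLocal_deg : IsLocal 1 fun X => deg X.graph X.root := by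
  rintro X Y ⟨e, he⟩
  have := deg_eq_of_ballIso (k := 0) X.locallyFinite Y.locallyFinite e he le_rfl
    (ballRoot X.graph X.root 1) (by simp [ballRoot])
  rwa [he] at this

theorem isLocal_embTrunc {h : ℕ} {H : SimpleGraph (Fin h)} (hH : H.Connected) (x : Fin h)
    (D : ℕ) : IsLocal (h + 1) fun X => embTrunc H x D X.graph X.root :=
  fun X Y hXY => embTrunc_eq_of_ballIso hH x D X.locallyFinite Y.locallyFinite hXY

/-! ### Isomorphism classes of balls -/

/-- Representatives of the isomorphism classes of finite connected rooted graphs. -/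
theorem exists_countable_representatives :
    ∃ (I : Type) (_ : Countable I) (H : I → RootedGraph), (∀ i, Finite (H i).V) ∧
      ∀ (V : Type) [Finite V] (G : SimpleGraph V) (v : V), G.Connected →
        ∃! i, RootedIso G v (H i).graph (H i).root := by
  -- Every finite vertex type can be relabelled as some `Fin n`, so the countable type `T` meets
  -- every class; the quotient makes the representative unique.
  let T := {t : Σ n, SimpleGraph (Fin n) × Fin n // t.2.1.Connected}
  let s : Setoid T :=
    { r := fun t u => RootedIso t.1.2.1 t.1.2.2 u.1.2.1 u.1.2.2
      iseqv := ⟨fun _ => ⟨SimpleGraph.Iso.refl, rfl⟩, RootedIso.symm, RootedIso.trans⟩ }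
  refine ⟨Quotient s, inferInstance, fun i => ⟨Fin i.out.1.1, i.out.1.2.1, i.out.1.2.2, i.out.2,
    fun _ => Set.toFinite _⟩, fun i => inferInstanceAs (Finite (Fin _)), ?_⟩
  intro V _ G v hG
  let e := Finite.equivFin V
  let t : T := ⟨⟨_, G.map e.toEmbedding, e v⟩, (SimpleGraph.Iso.map e G).connected_iff.mp hG⟩
  have ht : RootedIso G v t.1.2.1 t.1.2.2 := ⟨SimpleGraph.Iso.map e G, rfl⟩
  have hout : s.r (Quotient.mk s t).out t := Quotient.mk_out t
  refine ⟨Quotient.mk s t, ht.trans (RootedIso.symm hout), fun i hi => ?_⟩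
  rw [← Quotient.out_eq i]
  exact Quotient.sound (RootedIso.trans (RootedIso.symm hi) ht)

/-- The label `c` turns functions of the `r`-ball into functions on a countable set. -/
theorem exists_ballClass (r : ℕ) :
    ∃ (I : Type) (_ : Countable I) (H : I → RootedGraph) (c : PointedGraph → I),
      (∀ i, Finite (H i).V) ∧ ∀ X i, c X = i ↔
        RootedIso (ballGraph X.graph X.root r) (ballRoot X.graph X.root r)
          (H i).graph (H i).root := by
  obtain ⟨I, hI, H, hfin, hH⟩ := exists_countable_representatives
  have : ∀ X : PointedGraph, ∃! i, RootedIso (ballGraph X.graph X.root r)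
      (ballRoot X.graph X.root r) (H i).graph (H i).root := fun X =>
    have := (ballSet_finite X.locallyFinite X.root r).to_subtype
    hH _ _ _ (ballGraph_connected _ _ _)
  choose c hc hc' using this
  exact ⟨I, hI, H, c, hfin, fun X i => ⟨fun h => h ▸ hc X, fun h => (hc' X i h).symm⟩⟩

/-! ### Averages over the vertices -/

/-- The average of `F` over the vertices of `g`. -/
def vertexAvg (F : PointedGraph → ℝ) (g : FinGraph) : ℝ :=
  (g.size : ℝ)⁻¹ * ∑ i, F (g.pointed i)

theorem vertexAvg_mono {F F' : PointedGraph → ℝ} (hF : ∀ X, F X ≤ F' X) (g : FinGraph) :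
    vertexAvg F g ≤ vertexAvg F' g :=
  mul_le_mul_of_nonneg_left (Finset.sum_le_sum fun _ _ => hF _) (by positivity)

theorem vertexAvg_const (c : ℝ) (g : FinGraph) : vertexAvg (fun _ => c) g = c := by
  have : (g.size : ℝ) ≠ 0 := by exact_mod_cast g.size_pos.ne'
  simp [vertexAvg, this]

theorem vertexAvg_add (F F' : PointedGraph → ℝ) (g : FinGraph) :
    vertexAvg (fun X => F X + F' X) g = vertexAvg F g + vertexAvg F' g := by
  simp [vertexAvg, Finset.sum_add_distrib, mul_add]

theorem vertexAvg_nonneg {F : PointedGraph → ℝ} (hF : ∀ X, 0 ≤ F X) (g : FinGraph) :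
    0 ≤ vertexAvg F g :=
  mul_nonneg (by positivity) (Finset.sum_nonneg fun _ _ => hF _)

theorem abs_vertexAvg_le {F : PointedGraph → ℝ} {C : ℝ} (hF : ∀ X, |F X| ≤ C) (g : FinGraph) :
    |vertexAvg F g| ≤ C := by
  refine abs_le.mpr ⟨?_, ?_⟩
  · exact (vertexAvg_const (-C) g).symm.le.trans (vertexAvg_mono (fun X => (abs_le.mp (hF X)).1) g)
  · exact (vertexAvg_mono (fun X => (abs_le.mp (hF X)).2) g).trans (vertexAvg_const C g).le

theorem hasSum_ncard_fiber {I : Type*} {n : ℕ} (c : Fin n → I) (Φ : I → ℝ) :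
    HasSum (fun i => ({v | c v = i}.ncard : ℝ) / n * Φ i) ((n : ℝ)⁻¹ * ∑ v, Φ (c v)) := by
  classical
  have h1 : HasSum (fun i => ∑ v, if i = c v then Φ i else 0) (∑ v, Φ (c v)) :=
    hasSum_sum fun v _ => by
      have := hasSum_single (f := fun i => if i = c v then Φ i else 0) (c v)
        fun i hi => if_neg hi
      simpa using this
  refine (h1.mul_left (n : ℝ)⁻¹).congr_fun fun i => ?_
  have h2 : ({v | c v = i}.ncard : ℝ) = ∑ v, if i = c v then (1 : ℝ) else 0 := by
    rw [Finset.sum_boole, Set.ncard_eq_toFinset_card']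
    congr 2
    ext v
    simp [eq_comm]
  rw [h2, div_eq_inv_mul, mul_assoc, Finset.sum_mul]
  congr 1
  refine Finset.sum_congr rfl fun v _ => ?_
  split_ifs <;> simp

theorem hasSum_integral_singleton {I : Type*} [Countable I] [MeasurableSpace I]
    [MeasurableSingletonClass I] {μ : Measure I} {f : I → ℝ} (hf : Integrable f μ) :
    HasSum (fun i => μ.real {i} * f i) (∫ i, f i ∂μ) := by
  have hf' := hf
  rw [← Measure.sum_smul_dirac μ] at hf'
  have := hasSum_integral_measure hf'
  rw [Measure.sum_smul_dirac μ] at this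
  refine this.congr_fun fun i => ?_
  rw [integral_smul_measure, integral_dirac, smul_eq_mul, measureReal_def]

/-! ### Convergence of averages of bounded local functions -/

section Averages

variable {Ω : Type*} [MeasurableSpace Ω] {P : Measure Ω} [IsProbabilityMeasure P]

/-- Since `X ≥ 0`, the positive part lies between `0` and `c`, so no upper bound on `X` is needed:
it is at most `ε` off the event `|X - c| ≥ ε` and at most `c` on it. -/
theorem tendsto_integral_posPart_sub {X : ℕ → Ω → ℝ} {c : ℝ}
    (hX0 : ∀ n ω, 0 ≤ X n ω) (hc : 0 ≤ c) (hX : ∀ n, Measurable (X n))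
    (hlim : TendstoInMeasure P X atTop fun _ => c) :
    Tendsto (fun n => ∫ ω, max (c - X n ω) 0 ∂P) atTop (𝓝 0) := by
  rw [tendstoInMeasure_iff_measureReal_norm] at hlim
  have hbound : ∀ ε > 0, ∀ n, ∫ ω, max (c - X n ω) 0 ∂P ≤
      ε + c * P.real {ω | ε ≤ ‖X n ω - c‖} := by
    intro ε hε n
    have hs : MeasurableSet {ω | ε ≤ ‖X n ω - c‖} :=
      measurableSet_le measurable_const ((hX n).sub_const c).norm
    have hInt : Integrable ({ω | ε ≤ ‖X n ω - c‖}.indicator fun _ => c) P :=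
      (integrable_const c).indicator hs
    calc ∫ ω, max (c - X n ω) 0 ∂P
        ≤ ∫ ω, ε + {ω | ε ≤ ‖X n ω - c‖}.indicator (fun _ => c) ω ∂P := by
          refine integral_mono_of_nonneg (ae_of_all _ fun ω => le_max_right _ _)
            ((integrable_const ε).add hInt) (ae_of_all _ fun ω => ?_)
          by_cases hω : ε ≤ ‖X n ω - c‖
          · simp only [Set.indicator, Set.mem_ofPred_eq, hω, if_true]
            exact max_le (by linarith [hX0 n ω]) (by linarith)
          · simp only [Set.indicator, Set.mem_ofPred_eq, hω, if_false, add_zero]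
            rw [not_le, Real.norm_eq_abs, abs_lt] at hω
            exact max_le (by linarith [hω.1]) hε.le
      _ = ε + c * P.real {ω | ε ≤ ‖X n ω - c‖} := by
          rw [integral_add (integrable_const ε) hInt, integral_indicator_const _ hs]
          simp [mul_comm]
  rw [Metric.tendsto_atTop]
  intro ε hε
  have h1 := (hlim (ε / 2) (by positivity)).const_mul c
  rw [mul_zero] at h1
  obtain ⟨N, hN⟩ := Filter.eventually_atTop.mp (h1.eventually_lt_const (half_pos hε))
  refine ⟨N, fun n hn => ?_⟩
  rw [Real.dist_0_eq_abs, abs_of_nonneg (integral_nonneg fun ω => le_max_right _ _)]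
  linarith [hN n hn, hbound (ε / 2) (by positivity) n]

/-- This is Scheffé's lemma with random weights. As `p` and `q` have the same total mass, `∑ |p - q|
= 2 ∑ (q - p)⁺`. The terms on the right are dominated by the summable `q`, so their expectations may
be treated one index at a time. -/
theorem tendsto_integral_abs_tsum_sub {I : Type*} [Countable I] {p : ℕ → Ω → I → ℝ} {q : I → ℝ}
    (hpm : ∀ n i, Measurable fun ω => p n ω i) (hp0 : ∀ n ω i, 0 ≤ p n ω i)
    (hp1 : ∀ n ω, HasSum (p n ω) 1) (hq0 : ∀ i, 0 ≤ q i) (hq1 : HasSum q 1)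
    (hlim : ∀ i, TendstoInMeasure P (fun n ω => p n ω i) atTop fun _ => q i)
    {Φ : I → ℝ} {C : ℝ} (hC : 0 ≤ C) (hΦ : ∀ i, |Φ i| ≤ C) :
    Tendsto (fun n => ∫ ω, |∑' i, p n ω i * Φ i - ∑' i, q i * Φ i| ∂P) atTop (𝓝 0) := by
  have hle : ∀ n ω i, max (q i - p n ω i) 0 ≤ q i := fun n ω i =>
    max_le (by linarith [hp0 n ω i]) (hq0 i)
  have hsum : ∀ n ω, Summable fun i => max (q i - p n ω i) 0 := fun n ω =>
    Summable.of_nonneg_of_le (fun i => le_max_right _ _) (hle n ω) hq1.summable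
  have hmeas : ∀ n i, Measurable fun ω => max (q i - p n ω i) 0 := fun n i =>
    ((hpm n i).const_sub (q i)).max measurable_const
  have hInt : ∀ n i, Integrable (fun ω => max (q i - p n ω i) 0) P := fun n i =>
    Integrable.of_bound (hmeas n i).aestronglyMeasurable (q i) (ae_of_all _ fun ω => by
      rw [Real.norm_eq_abs, abs_of_nonneg (le_max_right _ _)]; exact hle n ω i)
  have hintle : ∀ n i, ∫ ω, max (q i - p n ω i) 0 ∂P ≤ q i := fun n i => by
    have := integral_mono (hInt n i) (integrable_const (q i)) (fun ω => hle n ω i)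
    simpa using this
  have hint0 : ∀ n i, 0 ≤ ∫ ω, max (q i - p n ω i) 0 ∂P := fun n i =>
    integral_nonneg fun ω => le_max_right _ _
  have hswap : ∀ n, ∫ ω, ∑' i, max (q i - p n ω i) 0 ∂P
      = ∑' i, ∫ ω, max (q i - p n ω i) 0 ∂P := fun n => by
    refine (hasSum_integral_of_summable_integral_norm (hInt n) ?_).tsum_eq.symm
    refine Summable.of_nonneg_of_le (fun i => by positivity) (fun i => ?_) hq1.summable
    refine le_trans (le_of_eq ?_) (hintle n i)
    exact integral_congr_ae (ae_of_all _ fun ω => by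
      simp only [Real.norm_eq_abs]; exact abs_of_nonneg (le_max_right _ _))
  have hsumint : ∀ n, Integrable (fun ω => ∑' i, max (q i - p n ω i) 0) P := fun n => by
    refine Integrable.of_bound (Measurable.aestronglyMeasurable ?_) 1 (ae_of_all _ fun ω => ?_)
    · exact measurable_of_tendsto_metrizable' (atTop : Filter (Finset I))
        (fun s => Finset.measurable_sum s fun i _ => hmeas n i)
        (tendsto_pi_nhds.mpr fun ω => (hsum n ω).hasSum)
    · rw [Real.norm_eq_abs, abs_of_nonneg (tsum_nonneg fun i => le_max_right _ _)]
      exact hasSum_le (hle n ω) (hsum n ω).hasSum hq1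
  have hpt : ∀ n ω, |∑' i, p n ω i * Φ i - ∑' i, q i * Φ i|
      ≤ 2 * C * ∑' i, max (q i - p n ω i) 0 := by
    intro n ω
    have hsm : ∀ a : I → ℝ, (∀ i, 0 ≤ a i) → Summable a → Summable fun i => a i * Φ i :=
      fun a ha hs => Summable.of_norm_bounded (hs.mul_right C) fun i => by
        rw [Real.norm_eq_abs, abs_mul, abs_of_nonneg (ha i)]
        exact mul_le_mul_of_nonneg_left (hΦ i) (ha i)
    have h1 := (hsm _ (hp0 n ω) (hp1 n ω).summable).hasSum.sub (hsm _ hq0 hq1.summable).hasSum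
    have h2 : HasSum (fun i => C * (2 * max (q i - p n ω i) 0 + (p n ω i - q i)))
        (C * (2 * ∑' i, max (q i - p n ω i) 0 + (1 - 1))) :=
      (((hsum n ω).hasSum.mul_left 2).add ((hp1 n ω).sub hq1)).mul_left C
    -- This rests on `|p - q| = 2 (q - p)⁺ + (p - q)`, whose last term sums to zero.
    have h3 : ∀ i, |p n ω i * Φ i - q i * Φ i|
        ≤ C * (2 * max (q i - p n ω i) 0 + (p n ω i - q i)) := fun i => by
      rw [← sub_mul, abs_mul, mul_comm]
      refine mul_le_mul (hΦ i) ?_ (abs_nonneg _) hC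
      refine abs_le.mpr ⟨?_, ?_⟩
      · linarith [le_max_left (q i - p n ω i) 0]
      · linarith [le_max_right (q i - p n ω i) 0]
    have h4 := hasSum_le (fun i => (abs_le.mp (h3 i)).2) h1 h2
    have h5 := hasSum_le (fun i => (abs_le.mp (h3 i)).1) h2.neg h1
    rw [abs_le]
    constructor <;> linarith
  have hlim0 : Tendsto (fun n => ∑' i, ∫ ω, max (q i - p n ω i) 0 ∂P) atTop (𝓝 0) := by
    have := tendsto_tsum_of_dominated_convergence (𝓕 := atTop)
      (f := fun n i => ∫ ω, max (q i - p n ω i) 0 ∂P) (g := fun _ => (0 : ℝ)) hq1.summable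
      (fun i => tendsto_integral_posPart_sub (fun n ω => hp0 n ω i) (hq0 i) (fun n => hpm n i)
        (hlim i))
      (Eventually.of_forall fun n i => by
        rw [Real.norm_eq_abs, abs_of_nonneg (hint0 n i)]; exact hintle n i)
    simpa using this
  have hlim1 := hlim0.const_mul (2 * C)
  rw [mul_zero] at hlim1
  refine squeeze_zero (fun n => integral_nonneg fun ω => abs_nonneg _) (fun n => ?_) hlim1
  rw [← hswap, ← integral_const_mul]
  exact integral_mono_of_nonneg (ae_of_all _ fun ω => abs_nonneg _) ((hsumint n).const_mul _)
    (ae_of_all _ (hpt n))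

variable {G : ℕ → Ω → FinGraph} {Gs : Ω → RootedGraph}

theorem tendsto_integral_abs_vertexAvg_sub (hG : ∀ n, Measurable (G n)) (hGs : Measurable Gs)
    (hconv : LocallyConvergesInProb P G Gs) {r : ℕ} {F : PointedGraph → ℝ} (hF : IsLocal r F)
    {C : ℝ} (hC : ∀ X, |F X| ≤ C) :
    Tendsto (fun n => ∫ ω, |vertexAvg F (G n ω) - ∫ ω', F (Gs ω').pointed ∂P| ∂P)
      atTop (𝓝 0) := by
  obtain ⟨I, hI, H, c, hfin, hc⟩ := exists_ballClass r
  let _ : MeasurableSpace I := ⊤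
  have hfac : F.FactorsThrough c := fun X Y hXY =>
    hF X Y (((hc X (c X)).mp rfl).trans ((hc Y (c X)).mp hXY.symm).symm)
  -- Classes that are not the `r`-ball of any pointed graph receive the value `0`.
  let Φ : I → ℝ := Function.extend c F 0
  have hΦ : ∀ X, Φ (c X) = F X := fun X => hfac.extend_apply 0 X
  -- The one-vertex graph serves only to witness that `C` is nonnegative.
  have hC0 : 0 ≤ C := (abs_nonneg _).trans (hC
    ⟨Unit, ⊥, (), fun _ => Set.toFinite _⟩)
  have hΦC : ∀ i, |Φ i| ≤ C := fun i => by
    by_cases hi : ∃ X, c X = i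
    · obtain ⟨X, rfl⟩ := hi
      rw [hΦ]; exact hC X
    · simp only [Φ, Function.extend_apply' _ _ _ hi, Pi.zero_apply, abs_zero, hC0]
  have hcloc : IsLocal r c := fun X Y hXY =>
    (hc X (c Y)).mpr (hXY.trans ((hc Y (c Y)).mp rfl))
  have hcm : Measurable fun ω => c (Gs ω).pointed := hcloc.measurable.comp hGs
  let μ : Measure I := P.map fun ω => c (Gs ω).pointed
  have hμ : IsProbabilityMeasure μ := Measure.isProbabilityMeasure_map hcm.aemeasurable
  have hfreq : ∀ (g : FinGraph) i, ballFreq r g (H i) =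
      ({v | c (g.pointed v) = i}.ncard : ℝ) / g.size := fun g i => by
    have : {v | c (g.pointed v) = i} = {v : Fin g.size |
        RootedIso (ballGraph g.graph v r) (ballRoot g.graph v r) (H i).graph (H i).root} := by
      ext v; exact hc (g.pointed v) i
    rw [ballFreq, this]
  have havg : ∀ (Ψ : I → ℝ) (g : FinGraph), HasSum (fun i => ballFreq r g (H i) * Ψ i)
      (vertexAvg (fun X => Ψ (c X)) g) := fun Ψ g => by
    have := hasSum_ncard_fiber (fun v => c (g.pointed v)) Ψ
    simpa only [hfreq, vertexAvg] using this
  have hq : ∀ i, μ.real {i} = P.real {ω | RootedIso (ballGraph (Gs ω).graph (Gs ω).root r)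
      (ballRoot (Gs ω).graph (Gs ω).root r) (H i).graph (H i).root} := fun i => by
    rw [measureReal_def, Measure.map_apply hcm (MeasurableSet.singleton i), measureReal_def]
    congr 2
    ext ω
    exact hc (Gs ω).pointed i
  have hInt : ∀ Ψ : I → ℝ, (∃ C, ∀ i, |Ψ i| ≤ C) →
      HasSum (fun i => μ.real {i} * Ψ i) (∫ i, Ψ i ∂μ) := fun Ψ ⟨C, hΨ⟩ =>
    hasSum_integral_singleton (Integrable.of_bound measurable_from_top.aestronglyMeasurable C
      (ae_of_all _ hΨ))
  have hFint : ∫ ω', F (Gs ω').pointed ∂P = ∑' i, μ.real {i} * Φ i := by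
    rw [(hInt Φ ⟨C, hΦC⟩).tsum_eq, integral_map hcm.aemeasurable
      measurable_from_top.aestronglyMeasurable]
    simp only [hΦ]
  have hone : HasSum (fun i => μ.real {i}) 1 := by
    have := hInt (fun _ => 1) ⟨1, fun _ => by simp⟩
    simpa using this
  have key := tendsto_integral_abs_tsum_sub (P := P) (p := fun n ω i => ballFreq r (G n ω) (H i))
    (q := fun i => μ.real {i}) (fun n i =>
      Measurable.comp (g := fun g => ballFreq r g (H i)) measurable_from_top (hG n))
    (fun n ω i => by rw [ballFreq]; positivity)
    (fun n ω => by
      have := havg (fun _ => 1) (G n ω)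
      simpa [vertexAvg_const] using this)
    (fun i => measureReal_nonneg) hone
    (fun i => by rw [hq]; exact hconv r (H i) (hfin i)) hC0 hΦC
  refine key.congr fun n => integral_congr_ae (ae_of_all _ fun ω => ?_)
  simp only [hFint, (havg Φ (G n ω)).tsum_eq, hΦ]

theorem integrable_vertexAvg {G : Ω → FinGraph} (hG : Measurable G) {F : PointedGraph → ℝ} {C : ℝ}
    (hC : ∀ X, |F X| ≤ C) : Integrable (fun ω => vertexAvg F (G ω)) P :=
  Integrable.of_bound
    (Measurable.comp (g := vertexAvg F) measurable_from_top hG).aestronglyMeasurable C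
    (ae_of_all _ fun _ => abs_vertexAvg_le hC _)

theorem tendsto_integral_vertexAvg (hG : ∀ n, Measurable (G n)) (hGs : Measurable Gs)
    (hconv : LocallyConvergesInProb P G Gs) {r : ℕ} {F : PointedGraph → ℝ} (hF : IsLocal r F)
    {C : ℝ} (hC : ∀ X, |F X| ≤ C) :
    Tendsto (fun n => ∫ ω, vertexAvg F (G n ω) ∂P) atTop
      (𝓝 (∫ ω, F (Gs ω).pointed ∂P)) := by
  rw [tendsto_iff_norm_sub_tendsto_zero]
  refine squeeze_zero (fun n => norm_nonneg _) (fun n => ?_)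
    (tendsto_integral_abs_vertexAvg_sub hG hGs hconv hF hC)
  have : ∫ ω, vertexAvg F (G n ω) ∂P - ∫ ω, F (Gs ω).pointed ∂P
      = ∫ ω, (vertexAvg F (G n ω) - ∫ ω', F (Gs ω').pointed ∂P) ∂P := by
    rw [integral_sub (integrable_vertexAvg (hG n) hC) (integrable_const _)]
    simp
  rw [this]
  exact norm_integral_le_integral_norm _

end Averages

/-! ### Uniformly random vertices -/

instance : Countable FinGraph :=
  Function.Injective.countable (f := fun g : FinGraph =>
    (⟨g.size, g.graph⟩ : Σ n, SimpleGraph (Fin n))) (by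
      rintro ⟨n, hn, g⟩ ⟨n', hn', g'⟩ h
      simp only [Sigma.mk.injEq] at h
      obtain ⟨rfl, h⟩ := h
      rw [eq_of_heq h])

theorem measurableSet_sigma_fin (s : Set (Σ g : FinGraph, Fin g.size)) : MeasurableSet s :=
  MeasurableSpace.measurableSet_iInf.mpr fun g =>
    show MeasurableSet (Sigma.mk g ⁻¹' s) from MeasurableSet.of_discrete

section UniformVertex

variable {Ω : Type*} [MeasurableSpace Ω] {P : Measure Ω}

/-- Both sides are the same countable sum over pairs `(g, i)`, with weights `P (G = g) / |g|`. -/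
theorem lintegral_uniformVertex {G : Ω → FinGraph} (hG : Measurable G)
    {v : (ω : Ω) → Fin (G ω).size} (hv : IsUniformVertex P G v)
    (φ : (Σ g : FinGraph, Fin g.size) → ENNReal) :
    ∫⁻ ω, φ ⟨G ω, v ω⟩ ∂P = ∫⁻ ω, ((G ω).size : ENNReal)⁻¹ * ∑ i, φ ⟨G ω, i⟩ ∂P := by
  have : MeasurableSingletonClass (Σ g : FinGraph, Fin g.size) := ⟨fun _ => measurableSet_sigma_fin _⟩
  have h1 : ∫⁻ ω, φ ⟨G ω, v ω⟩ ∂P = ∫⁻ t, φ t ∂(P.map fun ω => ⟨G ω, v ω⟩) :=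
    (lintegral_map (fun s _ => measurableSet_sigma_fin _) hv.measurable).symm
  have h2 : ∫⁻ ω, ((G ω).size : ENNReal)⁻¹ * ∑ i, φ ⟨G ω, i⟩ ∂P
      = ∫⁻ g, (g.size : ENNReal)⁻¹ * ∑ i, φ ⟨g, i⟩ ∂(P.map G) :=
    (lintegral_map (f := fun g : FinGraph => (g.size : ENNReal)⁻¹ * ∑ i, φ ⟨g, i⟩)
      measurable_from_top hG).symm
  rw [h1, h2, lintegral_countable', lintegral_countable', ENNReal.tsum_sigma']
  refine tsum_congr fun g => ?_
  rw [tsum_fintype, mul_comm (g.size : ENNReal)⁻¹, mul_assoc, Finset.sum_mul]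
  refine Finset.sum_congr rfl fun i _ => ?_
  rw [Measure.map_apply hv.measurable (measurableSet_sigma_fin _), Measure.map_apply hG trivial]
  have := hv.uniform g i
  rw [div_eq_mul_inv, mul_comm] at this
  exact congrArg (φ ⟨g, i⟩ * ·) this

/-- This removes the random vertex: statements about `d_n` become statements about vertex averages
of `G n`. -/
theorem integrable_and_integral_uniformVertex {G : Ω → FinGraph} (hG : Measurable G)
    {v : (ω : Ω) → Fin (G ω).size} (hv : IsUniformVertex P G v) {F : PointedGraph → ℝ}
    (hF : ∀ X, 0 ≤ F X) :
    (Integrable (fun ω => F ((G ω).pointed (v ω))) P ↔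
      Integrable (fun ω => vertexAvg F (G ω)) P) ∧
    ∫ ω, F ((G ω).pointed (v ω)) ∂P = ∫ ω, vertexAvg F (G ω) ∂P := by
  have hm1 : AEStronglyMeasurable (fun ω => F ((G ω).pointed (v ω))) P :=
    (Measurable.comp (g := fun t : Σ g : FinGraph, Fin g.size => F (t.1.pointed t.2))
      (fun _ _ => measurableSet_sigma_fin _) hv.measurable).aestronglyMeasurable
  have hm2 : AEStronglyMeasurable (fun ω => vertexAvg F (G ω)) P :=
    (Measurable.comp (g := vertexAvg F) measurable_from_top hG).aestronglyMeasurable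
  have hl : ∫⁻ ω, ENNReal.ofReal (F ((G ω).pointed (v ω))) ∂P
      = ∫⁻ ω, ENNReal.ofReal (vertexAvg F (G ω)) ∂P := by
    rw [lintegral_uniformVertex hG hv fun t => ENNReal.ofReal (F (t.1.pointed t.2))]
    refine lintegral_congr fun ω => ?_
    have hpos : (0 : ℝ) < (G ω).size := by exact_mod_cast (G ω).size_pos
    rw [vertexAvg, ENNReal.ofReal_mul (by positivity), ENNReal.ofReal_inv_of_pos hpos,
      ENNReal.ofReal_natCast, ENNReal.ofReal_sum_of_nonneg fun _ _ => hF _]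
  refine ⟨?_, ?_⟩
  · rw [← lintegral_ofReal_ne_top_iff_integrable hm1 (ae_of_all _ fun _ => hF _),
      ← lintegral_ofReal_ne_top_iff_integrable hm2 (ae_of_all _ fun _ => vertexAvg_nonneg hF _), hl]
  · rw [integral_eq_lintegral_of_nonneg_ae (ae_of_all _ fun _ => hF _) hm1,
      integral_eq_lintegral_of_nonneg_ae (ae_of_all _ fun _ => vertexAvg_nonneg hF _) hm2, hl]

end UniformVertex

/-! ### Truncated functions of the degree -/

/-- `φ` of the degree of the distinguished vertex. -/
def degFun (φ : ℕ → ℝ) (X : PointedGraph) : ℝ :=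
  φ (deg X.graph X.root)

/-- `φ` restricted to arguments at most `M`. -/
def lowPart (φ : ℕ → ℝ) (M d : ℕ) : ℝ :=
  if M < d then 0 else φ d

/-- `φ` restricted to arguments more than `M`. -/
def tailPart (φ : ℕ → ℝ) (M d : ℕ) : ℝ :=
  if M < d then φ d else 0

theorem isLocal_degFun (φ : ℕ → ℝ) : IsLocal 1 (degFun φ) :=
  isLocal_deg.comp φ

theorem lowPart_add_tailPart (φ : ℕ → ℝ) (M d : ℕ) : lowPart φ M d + tailPart φ M d = φ d := by
  unfold lowPart tailPart; split_ifs <;> simp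

theorem tailPart_nonneg {φ : ℕ → ℝ} (hφ : ∀ d, 0 ≤ φ d) (M d : ℕ) : 0 ≤ tailPart φ M d := by
  unfold tailPart; split_ifs <;> simp [hφ]

theorem tailPart_le {φ : ℕ → ℝ} (hφ : ∀ d, 0 ≤ φ d) (M d : ℕ) : tailPart φ M d ≤ φ d := by
  unfold tailPart; split_ifs <;> simp [hφ]

theorem degFun_tailPart_nonneg {φ : ℕ → ℝ} (hφ : ∀ d, 0 ≤ φ d) (M : ℕ) (X : PointedGraph) :
    0 ≤ degFun (tailPart φ M) X :=
  tailPart_nonneg hφ M _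

theorem degFun_tailPart_le {φ : ℕ → ℝ} (hφ : ∀ d, 0 ≤ φ d) (M : ℕ) (X : PointedGraph) :
    degFun (tailPart φ M) X ≤ degFun φ X :=
  tailPart_le hφ M _

theorem tailPart_antitone {φ : ℕ → ℝ} (hφ : ∀ d, 0 ≤ φ d) {M M' : ℕ} (hM : M ≤ M') (d : ℕ) :
    tailPart φ M' d ≤ tailPart φ M d := by
  unfold tailPart
  split_ifs with h1 h2
  · exact le_rfl
  · omega
  · exact hφ d
  · exact le_rfl

theorem exists_abs_lowPart_le (φ : ℕ → ℝ) (M : ℕ) : ∃ C, ∀ d, |lowPart φ M d| ≤ C := by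
  refine ⟨∑ d ∈ Finset.range (M + 1), |φ d|, fun d => ?_⟩
  unfold lowPart
  split_ifs with h
  · simpa using Finset.sum_nonneg fun i _ => abs_nonneg (φ i)
  · exact Finset.single_le_sum (f := fun d => |φ d|) (fun i _ => abs_nonneg _)
      (Finset.mem_range.mpr (by omega))

theorem tendsto_tailPart (φ : ℕ → ℝ) (d : ℕ) : Tendsto (fun M => tailPart φ M d) atTop (𝓝 0) := by
  refine tendsto_const_nhds.congr' ?_
  filter_upwards [eventually_ge_atTop d] with M hM
  exact (if_neg (not_lt.mpr hM)).symm

/-! ### Small tails and convergence of means -/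

section Moments

variable {Ω : Type*} [MeasurableSpace Ω] {P : Measure Ω}
  {G : ℕ → Ω → FinGraph} {Gs : Ω → RootedGraph}

variable (P G) in
/-- The averages of `φ(degree)` are integrable, with uniformly small contributions of the vertices
of large degree. -/
def SmallTails (φ : ℕ → ℝ) : Prop :=
  (∀ n, Integrable (fun ω => vertexAvg (degFun φ) (G n ω)) P) ∧
  ∀ ε > 0, ∀ᶠ M in atTop, ∀ n, ∫ ω, vertexAvg (degFun (tailPart φ M)) (G n ω) ∂P ≤ ε

theorem integrable_vertexAvg_of_le {g : Ω → FinGraph} (hg : Measurable g) {F : PointedGraph → ℝ}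
    (hF : ∀ X, 0 ≤ F X) {B : Ω → ℝ} (hB : Integrable B P) (hle : ∀ ω, vertexAvg F (g ω) ≤ B ω) :
    Integrable (fun ω => vertexAvg F (g ω)) P :=
  hB.mono' (Measurable.comp (g := vertexAvg F) measurable_from_top hg).aestronglyMeasurable
    (ae_of_all _ fun ω => by
      rw [Real.norm_eq_abs, abs_of_nonneg (vertexAvg_nonneg hF _)]; exact hle ω)

theorem integrable_vertexAvg_tailPart {g : Ω → FinGraph} (hg : Measurable g) {φ : ℕ → ℝ}
    (hφ : ∀ d, 0 ≤ φ d) (hInt : Integrable (fun ω => vertexAvg (degFun φ) (g ω)) P) (M : ℕ) :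
    Integrable (fun ω => vertexAvg (degFun (tailPart φ M)) (g ω)) P :=
  integrable_vertexAvg_of_le hg (degFun_tailPart_nonneg hφ M) hInt fun ω =>
    vertexAvg_mono (degFun_tailPart_le hφ M) (g ω)

theorem tendsto_integral_tailPart_root (hGs : Measurable Gs) {φ : ℕ → ℝ} (hφ : ∀ d, 0 ≤ φ d)
    (hInt : Integrable (fun ω => degFun φ (Gs ω).pointed) P) :
    Tendsto (fun M => ∫ ω, degFun (tailPart φ M) (Gs ω).pointed ∂P) atTop (𝓝 0) := by
  have := tendsto_integral_of_dominated_convergence (μ := P)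
    (F := fun M ω => degFun (tailPart φ M) (Gs ω).pointed) (f := fun _ => (0 : ℝ))
    (fun ω => degFun φ (Gs ω).pointed)
    (fun M => ((isLocal_degFun (tailPart φ M)).measurable.comp hGs).aestronglyMeasurable) hInt
    (fun M => ae_of_all _ fun ω => by
      rw [Real.norm_eq_abs, abs_of_nonneg (degFun_tailPart_nonneg hφ M _)]
      exact degFun_tailPart_le hφ M _)
    (ae_of_all _ fun ω => tendsto_tailPart φ _)
  simpa using this

theorem tendsto_integral_vertexAvg_tailPart {g : Ω → FinGraph} (hg : Measurable g) {φ : ℕ → ℝ}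
    (hφ : ∀ d, 0 ≤ φ d) (hInt : Integrable (fun ω => vertexAvg (degFun φ) (g ω)) P) :
    Tendsto (fun M => ∫ ω, vertexAvg (degFun (tailPart φ M)) (g ω) ∂P) atTop (𝓝 0) := by
  have := tendsto_integral_of_dominated_convergence (μ := P)
    (F := fun M ω => vertexAvg (degFun (tailPart φ M)) (g ω)) (f := fun _ => (0 : ℝ))
    (fun ω => vertexAvg (degFun φ) (g ω))
    (fun M => (integrable_vertexAvg_tailPart hg hφ hInt M).aestronglyMeasurable) hInt
    (fun M => ae_of_all _ fun ω => by
      rw [Real.norm_eq_abs, abs_of_nonneg (vertexAvg_nonneg (degFun_tailPart_nonneg hφ M) _)]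
      exact vertexAvg_mono (degFun_tailPart_le hφ M) _)
    (ae_of_all _ fun ω => by
      have := (tendsto_finsetSum Finset.univ fun i _ =>
        tendsto_tailPart φ (deg (g ω).graph i)).const_mul ((g ω).size : ℝ)⁻¹
      simpa [vertexAvg, degFun, FinGraph.pointed] using this)
  simpa using this

variable {v : (n : ℕ) → (ω : Ω) → Fin (G n ω).size}

theorem degreeMomentConverges_iff (hG : ∀ n, Measurable (G n))
    (hv : ∀ n, IsUniformVertex P (G n) (v n)) (k : ℕ) :
    DegreeMomentConverges P G v Gs k ↔
      (∀ n, Integrable (fun ω => vertexAvg (degFun fun d => (d : ℝ) ^ k) (G n ω)) P) ∧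
      Tendsto (fun n => ∫ ω, vertexAvg (degFun fun d => (d : ℝ) ^ k) (G n ω) ∂P) atTop
        (𝓝 (∫ ω, degFun (fun d => (d : ℝ) ^ k) (Gs ω).pointed ∂P)) := by
  have hpow := fun n => integrable_and_integral_uniformVertex (hG n) (hv n)
    (F := degFun fun d => (d : ℝ) ^ k) fun X => by unfold degFun; positivity
  refine and_congr (forall_congr' fun n => (hpow n).1) ?_
  simp only [← fun n => (hpow n).2]
  rfl

variable [IsProbabilityMeasure P]

theorem integral_vertexAvg_degFun {g : Ω → FinGraph} (hg : Measurable g) {φ : ℕ → ℝ}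
    (hφ : ∀ d, 0 ≤ φ d) (hInt : Integrable (fun ω => vertexAvg (degFun φ) (g ω)) P) (M : ℕ) :
    ∫ ω, vertexAvg (degFun φ) (g ω) ∂P = ∫ ω, vertexAvg (degFun (lowPart φ M)) (g ω) ∂P +
      ∫ ω, vertexAvg (degFun (tailPart φ M)) (g ω) ∂P := by
  obtain ⟨C, hC⟩ := exists_abs_lowPart_le φ M
  rw [← integral_add (integrable_vertexAvg (F := degFun (lowPart φ M)) hg fun X => hC _)
    (integrable_vertexAvg_tailPart hg hφ hInt M)]
  refine integral_congr_ae (ae_of_all _ fun ω => ?_)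
  simp only [← vertexAvg_add, degFun, lowPart_add_tailPart]
  rfl

theorem integral_degFun_root (hGs : Measurable Gs) {φ : ℕ → ℝ}
    (hφ : ∀ d, 0 ≤ φ d) (hInt : Integrable (fun ω => degFun φ (Gs ω).pointed) P) (M : ℕ) :
    ∫ ω, degFun φ (Gs ω).pointed ∂P = ∫ ω, degFun (lowPart φ M) (Gs ω).pointed ∂P +
      ∫ ω, degFun (tailPart φ M) (Gs ω).pointed ∂P := by
  obtain ⟨C, hC⟩ := exists_abs_lowPart_le φ M
  have hm : ∀ ψ : ℕ → ℝ, AEStronglyMeasurable (fun ω => degFun ψ (Gs ω).pointed) P := fun ψ =>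
    ((isLocal_degFun ψ).measurable.comp hGs).aestronglyMeasurable
  rw [← integral_add (Integrable.of_bound (hm (lowPart φ M)) C (ae_of_all _ fun ω => hC _))
    (hInt.mono' (hm _) (ae_of_all _ fun ω => by
      rw [Real.norm_eq_abs, abs_of_nonneg (degFun_tailPart_nonneg hφ M _)]
      exact degFun_tailPart_le hφ M _))]
  refine integral_congr_ae (ae_of_all _ fun ω => ?_)
  simp only [degFun, lowPart_add_tailPart]

theorem tendsto_integral_vertexAvg_lowPart (hG : ∀ n, Measurable (G n)) (hGs : Measurable Gs)
    (hconv : LocallyConvergesInProb P G Gs) (φ : ℕ → ℝ) (M : ℕ) :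
    Tendsto (fun n => ∫ ω, vertexAvg (degFun (lowPart φ M)) (G n ω) ∂P) atTop
      (𝓝 (∫ ω, degFun (lowPart φ M) (Gs ω).pointed ∂P)) :=
  let ⟨_, hC⟩ := exists_abs_lowPart_le φ M
  tendsto_integral_vertexAvg hG hGs hconv (isLocal_degFun _) fun _ => hC _

/-- Convergence of the means of `φ(degree)` gives uniform integrability. -/
theorem smallTails_of_tendsto (hG : ∀ n, Measurable (G n)) (hGs : Measurable Gs)
    (hconv : LocallyConvergesInProb P G Gs) {φ : ℕ → ℝ} (hφ : ∀ d, 0 ≤ φ d)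
    (hInt : Integrable (fun ω => degFun φ (Gs ω).pointed) P)
    (hintn : ∀ n, Integrable (fun ω => vertexAvg (degFun φ) (G n ω)) P)
    (hlim : Tendsto (fun n => ∫ ω, vertexAvg (degFun φ) (G n ω) ∂P) atTop
      (𝓝 (∫ ω, degFun φ (Gs ω).pointed ∂P))) : SmallTails P G φ := by
  refine ⟨hintn, fun ε hε => ?_⟩
  obtain ⟨M₀, hM₀⟩ := ((tendsto_integral_tailPart_root hGs hφ hInt).eventually_lt_const hε).exists
  -- The tail mean is the full mean minus the mean of the bounded low part, and both of these
  -- converge.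
  have hlim₀ : Tendsto (fun n => ∫ ω, vertexAvg (degFun (tailPart φ M₀)) (G n ω) ∂P) atTop
      (𝓝 (∫ ω, degFun (tailPart φ M₀) (Gs ω).pointed ∂P)) := by
    have h1 := hlim.sub (tendsto_integral_vertexAvg_lowPart hG hGs hconv φ M₀)
    rw [integral_degFun_root hGs hφ hInt M₀, add_sub_cancel_left] at h1
    refine h1.congr fun n => ?_
    rw [integral_vertexAvg_degFun (hG n) hφ (hintn n) M₀, add_sub_cancel_left]
  obtain ⟨N, hN⟩ := eventually_atTop.mp (hlim₀.eventually_lt_const hM₀)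
  -- The finitely many `n < N` are handled one by one through integrability; for `n ≥ N` the level
  -- `M₀` already suffices, and tails decrease in `M`.
  have hfin : ∀ᶠ M in atTop, ∀ n ∈ Finset.range N,
      ∫ ω, vertexAvg (degFun (tailPart φ M)) (G n ω) ∂P < ε :=
    (Finset.eventually_all _).mpr fun n _ =>
      (tendsto_integral_vertexAvg_tailPart (hG n) hφ (hintn n)).eventually_lt_const hε
  filter_upwards [hfin, eventually_ge_atTop M₀] with M hM hMM₀ n
  by_cases hn : n < N
  · exact (hM n (Finset.mem_range.mpr hn)).le
  · refine le_trans ?_ (hN n (not_lt.mp hn)).le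
    exact integral_mono (integrable_vertexAvg_tailPart (hG n) hφ (hintn n) M)
      (integrable_vertexAvg_tailPart (hG n) hφ (hintn n) M₀)
      fun ω => vertexAvg_mono (fun _ => tailPart_antitone hφ hMM₀ _) _

/-- Uniform integrability gives convergence of the means of `φ(degree)`. -/
theorem SmallTails.tendsto (hG : ∀ n, Measurable (G n)) (hGs : Measurable Gs)
    (hconv : LocallyConvergesInProb P G Gs) {φ : ℕ → ℝ} (hφ : ∀ d, 0 ≤ φ d)
    (hInt : Integrable (fun ω => degFun φ (Gs ω).pointed) P) (htail : SmallTails P G φ) :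
    Tendsto (fun n => ∫ ω, vertexAvg (degFun φ) (G n ω) ∂P) atTop
      (𝓝 (∫ ω, degFun φ (Gs ω).pointed ∂P)) := by
  rw [Metric.tendsto_atTop]
  intro ε hε
  obtain ⟨M, hM, hM'⟩ := ((htail.2 (ε / 3) (by positivity)).and
    ((tendsto_integral_tailPart_root hGs hφ hInt).eventually_lt_const
      (show 0 < ε / 3 by positivity))).exists
  obtain ⟨N, hN⟩ := Metric.tendsto_atTop.mp
    (tendsto_integral_vertexAvg_lowPart hG hGs hconv φ M) (ε / 3) (by positivity)
  refine ⟨N, fun n hn => ?_⟩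
  have h1 := hN n hn
  have h2 := hM n
  have h3 : 0 ≤ ∫ ω, vertexAvg (degFun (tailPart φ M)) (G n ω) ∂P :=
    integral_nonneg fun ω => vertexAvg_nonneg (degFun_tailPart_nonneg hφ M) _
  have h4 : 0 ≤ ∫ ω, degFun (tailPart φ M) (Gs ω).pointed ∂P :=
    integral_nonneg fun ω => degFun_tailPart_nonneg hφ M _
  rw [integral_vertexAvg_degFun (hG n) hφ (htail.1 n) M, integral_degFun_root hGs hφ hInt M]
  rw [Real.dist_eq, abs_lt] at h1 ⊢
  constructor <;> linarith [h1.1, h1.2]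

/-! ### Falling factorials against powers, and uniform integrability -/

/-- Each factor of the falling factorial is at least `d + 1 - k`, hence at least `d / 2`. -/
theorem pow_le_two_pow_mul_descFactorial {k d : ℕ} (hd : 2 * k ≤ d) :
    d ^ k ≤ 2 ^ k * d.descFactorial k :=
  calc d ^ k ≤ (2 * (d + 1 - k)) ^ k := Nat.pow_le_pow_left (by omega) k
    _ = 2 ^ k * (d + 1 - k) ^ k := mul_pow _ _ _
    _ ≤ 2 ^ k * d.descFactorial k := Nat.mul_le_mul_left _ (Nat.pow_sub_le_descFactorial d k)

/-- Degrees up to `2 * k` contribute at most the constant `(2 * k) ^ k`, which matters only for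
integrability; tails beyond `2 * k` compare termwise with factor `2 ^ k`. -/
theorem SmallTails.pow_of_descFactorial (hG : ∀ n, Measurable (G n)) {k : ℕ}
    (htail : SmallTails P G fun d => (d.descFactorial k : ℝ)) :
    SmallTails P G fun d => (d : ℝ) ^ k := by
  have hnn : ∀ d : ℕ, (0 : ℝ) ≤ (d.descFactorial k : ℝ) := fun d => Nat.cast_nonneg _
  have hpow : ∀ d : ℕ, 2 * k ≤ d → (d : ℝ) ^ k ≤ 2 ^ k * (d.descFactorial k : ℝ) := fun d hd => by
    exact_mod_cast pow_le_two_pow_mul_descFactorial hd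
  have hsmul : ∀ (F : PointedGraph → ℝ) (g : FinGraph),
      vertexAvg (fun X => 2 ^ k * F X) g = 2 ^ k * vertexAvg F g := fun F g => by
    simp only [vertexAvg, ← Finset.mul_sum]; ring
  refine ⟨fun n => ?_, fun ε hε => ?_⟩
  · refine integrable_vertexAvg_of_le (hG n) (fun X => by unfold degFun; positivity)
      ((integrable_const ((2 * k : ℝ) ^ k)).add ((htail.1 n).const_mul (2 ^ k))) fun ω => ?_
    refine le_trans (vertexAvg_mono (F' := fun X => (2 * k : ℝ) ^ k +
      2 ^ k * degFun (fun d => (d.descFactorial k : ℝ)) X) (fun X => ?_) _) (le_of_eq ?_)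
    · unfold degFun
      rcases le_total (2 * k) (deg X.graph X.root) with hd | hd
      · exact (hpow _ hd).trans (le_add_of_nonneg_left (by positivity))
      · refine le_trans (pow_le_pow_left₀ (by positivity) ?_ k)
          (le_add_of_nonneg_right (by positivity))
        exact_mod_cast hd
    · rw [vertexAvg_add, vertexAvg_const, hsmul]
      rfl
  · filter_upwards [htail.2 (ε / 2 ^ k) (by positivity), eventually_ge_atTop (2 * k)]
      with M hM hMk n
    have h1 : ∫ ω, vertexAvg (degFun (tailPart (fun d => (d : ℝ) ^ k) M)) (G n ω) ∂P ≤
        ∫ ω, 2 ^ k * vertexAvg (degFun (tailPart (fun d => (d.descFactorial k : ℝ)) M))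
          (G n ω) ∂P := by
      refine integral_mono_of_nonneg (ae_of_all _ fun ω => vertexAvg_nonneg
          (fun _ => tailPart_nonneg (fun d => by positivity) M _) _)
        ((integrable_vertexAvg_tailPart (hG n) hnn (htail.1 n) M).const_mul _)
        (ae_of_all _ fun ω => ?_)
      simp only [← hsmul]
      refine vertexAvg_mono (fun X => ?_) _
      unfold degFun tailPart
      split_ifs with hd
      · exact hpow _ (by omega)
      · simp
    rw [integral_const_mul] at h1
    have h2 := hM n
    rw [le_div_iff₀ (by positivity)] at h2
    linarith

/-- Uniform integrability cuts at a level of `d ^ k`, small tails at a level of `d`; for `k ≠ 0` the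
two kinds of level are interchangeable. -/
theorem degreePowerUniformIntegrable_iff (hG : ∀ n, Measurable (G n))
    (hv : ∀ n, IsUniformVertex P (G n) (v n)) {k : ℕ} (hk : k ≠ 0) :
    DegreePowerUniformIntegrable P G v k ↔ SmallTails P G fun d => (d : ℝ) ^ k := by
  have hφ : ∀ d : ℕ, (0 : ℝ) ≤ (d : ℝ) ^ k := fun d => by positivity
  have hpow := fun n => integrable_and_integral_uniformVertex (hG n) (hv n)
    (F := degFun fun d => (d : ℝ) ^ k) fun X => hφ _
  have htl := fun M n => integrable_and_integral_uniformVertex (hG n) (hv n)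
    (F := degFun (tailPart (fun d => (d : ℝ) ^ k) M)) (degFun_tailPart_nonneg hφ M)
  constructor
  · intro hUI
    have hInt : ∀ n, Integrable (fun ω => vertexAvg (degFun fun d => (d : ℝ) ^ k) (G n ω)) P :=
      fun n => (hpow n).1.mp (memLp_one_iff_integrable.mp (hUI.memLp n))
    refine ⟨hInt, fun ε hε => ?_⟩
    obtain ⟨C, hC⟩ := ((uniformIntegrable_iff le_rfl ENNReal.one_ne_top).mp hUI).2 ε hε
    -- If `d > M ≥ C` then `d ≥ 1`, so `d ^ k ≥ d ≥ C`.
    filter_upwards [eventually_ge_atTop ⌈(C : ℝ)⌉₊] with M hM n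
    rw [← (htl M n).2, integral_eq_lintegral_of_nonneg_ae
      (ae_of_all _ fun ω => degFun_tailPart_nonneg hφ M _)
      ((htl M n).1.mpr (integrable_vertexAvg_tailPart (hG n) hφ (hInt n) M)).aestronglyMeasurable]
    refine ENNReal.toReal_le_of_le_ofReal hε.le (le_trans ?_ (hC n))
    rw [eLpNorm_one_eq_lintegral_enorm]
    refine lintegral_mono fun ω => ?_
    unfold degFun tailPart
    split_ifs with hd
    · have hmem : ω ∈ {ω | C ≤ ‖(deg (G n ω).graph (v n ω) : ℝ) ^ k‖₊} := by
        have h1 : (C : ℝ) ≤ deg (G n ω).graph (v n ω) :=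
          (Nat.le_ceil _).trans (by exact_mod_cast hM.trans hd.le)
        have h2 : (1 : ℝ) ≤ deg (G n ω).graph (v n ω) := by
          exact_mod_cast (Nat.zero_le M).trans_lt hd
        have h3 := h1.trans (le_self_pow₀ h2 hk)
        rw [Set.mem_ofPred_eq, ← NNReal.coe_le_coe, coe_nnnorm, Real.norm_eq_abs]
        exact h3.trans (le_abs_self _)
      rw [Set.indicator_of_mem hmem, Real.enorm_eq_ofReal (by positivity)]
      exact le_rfl
    · simp
  · rintro ⟨hInt, htail⟩
    refine (uniformIntegrable_iff le_rfl ENNReal.one_ne_top).mpr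
      ⟨fun n => ((hpow n).1.mpr (hInt n)).aestronglyMeasurable, fun ε hε => ?_⟩
    obtain ⟨M, hM⟩ := (htail ε hε).exists
    -- With this level, `d ^ k` reaches it exactly when `d > M`.
    refine ⟨((M + 1 : ℕ) : NNReal) ^ k, fun n => ?_⟩
    rw [eLpNorm_one_eq_lintegral_enorm]
    have hInt' := (htl M n).1.mpr (integrable_vertexAvg_tailPart (hG n) hφ (hInt n) M)
    calc ∫⁻ ω, ‖{ω | ((M + 1 : ℕ) : NNReal) ^ k ≤ ‖(deg (G n ω).graph (v n ω) : ℝ) ^ k‖₊}.indicator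
            (fun ω => (deg (G n ω).graph (v n ω) : ℝ) ^ k) ω‖ₑ ∂P
        ≤ ∫⁻ ω, ENNReal.ofReal (degFun (tailPart (fun d => (d : ℝ) ^ k) M)
            ((G n ω).pointed (v n ω))) ∂P := by
          refine lintegral_mono fun ω => ?_
          by_cases hmem : ω ∈ {ω | ((M + 1 : ℕ) : NNReal) ^ k ≤
              ‖(deg (G n ω).graph (v n ω) : ℝ) ^ k‖₊}
          · have hd : M < deg (G n ω).graph (v n ω) := by
              rw [Set.mem_ofPred_eq, nnnorm_pow, Real.nnnorm_natCast,
                pow_le_pow_iff_left₀ (by positivity) (by positivity) hk] at hmem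
              exact_mod_cast hmem
            rw [Set.indicator_of_mem hmem, Real.enorm_eq_ofReal (by positivity)]
            refine ENNReal.ofReal_le_ofReal (le_of_eq ?_)
            exact (if_pos hd).symm
          · rw [Set.indicator_of_notMem hmem]; simp
      _ = ENNReal.ofReal (∫ ω, degFun (tailPart (fun d => (d : ℝ) ^ k) M)
            ((G n ω).pointed (v n ω)) ∂P) :=
          (ofReal_integral_eq_lintegral_ofReal hInt'
            (ae_of_all _ fun ω => degFun_tailPart_nonneg hφ M _)).symm
      _ ≤ ENNReal.ofReal ε := ENNReal.ofReal_le_ofReal ((htl M n).2 ▸ hM n)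

/-! ### Means of embedding counts -/

theorem inv_size_mul_emb {h : ℕ} (H : SimpleGraph (Fin h)) (x : Fin h) (g : FinGraph) :
    (g.size : ℝ)⁻¹ * (emb H g.graph : ℝ) =
      vertexAvg (fun X => (embRooted H x X.graph X.root : ℝ)) g := by
  rw [emb_eq_sum_embRooted H x, vertexAvg]
  push_cast
  rfl

theorem inv_size_mul_emb_le {h : ℕ} {H : SimpleGraph (Fin h)} (hH : H.Connected) (x : Fin h)
    (M : ℕ) (g : FinGraph) :
    (g.size : ℝ)⁻¹ * (emb H g.graph : ℝ) ≤
      vertexAvg (fun X => (embTrunc H x M X.graph X.root : ℝ)) g +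
        h * vertexAvg (degFun (tailPart (fun d => (d : ℝ) ^ (h - 1)) M)) g := by
  have h1 : (emb H g.graph : ℝ) ≤ ((∑ v, embTrunc H x M g.graph v +
      h * ∑ v, (if M < deg g.graph v then deg g.graph v ^ (h - 1) else 0) : ℕ) : ℝ) := by
    exact_mod_cast emb_le_sum_embTrunc_add hH x g.graph M
  refine (mul_le_mul_of_nonneg_left h1 (by positivity)).trans (le_of_eq ?_)
  unfold vertexAvg degFun tailPart
  push_cast
  rw [mul_add, mul_left_comm]
  rfl

theorem abs_embTrunc_le {h : ℕ} {H : SimpleGraph (Fin h)} (hH : H.Connected) (x : Fin h)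
    (M : ℕ) (X : PointedGraph) :
    |(embTrunc H x M X.graph X.root : ℝ)| ≤ (M : ℝ) ^ (h - 1) := by
  rw [Nat.abs_cast]
  exact_mod_cast card_truncCopy_le hH x X.locallyFinite X.root M

/-- The count is the pointwise limit of its truncations, which are local and hence measurable. -/
theorem measurable_embRooted {h : ℕ} {H : SimpleGraph (Fin h)} (hH : H.Connected) (x : Fin h)
    (hGs : Measurable Gs) :
    Measurable fun ω => (embRooted H x (Gs ω).graph (Gs ω).root : ℝ) :=
  measurable_of_tendsto_metrizable
    (f := fun D ω => (embTrunc H x D (Gs ω).graph (Gs ω).root : ℝ))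
    (fun D => ((isLocal_embTrunc hH x D).comp (Nat.cast : ℕ → ℝ)).measurable.comp hGs)
    (tendsto_pi_nhds.mpr fun ω => tendsto_const_nhds.congr' (by
      filter_upwards [embTrunc_eventually_eq hH x (Gs ω).locallyFinite (Gs ω).root] with D hD
      rw [hD]))

/-- Uniform integrability gives convergence in mean of the normalized embedding counts. -/
theorem SmallTails.tendsto_integral_abs_emb_sub (hG : ∀ n, Measurable (G n))
    (hGs : Measurable Gs) (hconv : LocallyConvergesInProb P G Gs) {h : ℕ}
    (htail : SmallTails P G fun d => (d : ℝ) ^ (h - 1)) {H : SimpleGraph (Fin h)}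
    (hH : H.Connected) (x : Fin h) :
    (∀ n, Integrable (fun ω => ((G n ω).size : ℝ)⁻¹ * (emb H (G n ω).graph : ℝ)) P) ∧
    Integrable (fun ω => (embRooted H x (Gs ω).graph (Gs ω).root : ℝ)) P ∧
    Tendsto (fun n => ∫ ω, |((G n ω).size : ℝ)⁻¹ * (emb H (G n ω).graph : ℝ) -
      ∫ ω', (embRooted H x (Gs ω').graph (Gs ω').root : ℝ) ∂P| ∂P) atTop (𝓝 0) := by
  have hφ : ∀ d : ℕ, (0 : ℝ) ≤ (d : ℝ) ^ (h - 1) := fun d => by positivity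
  let T : ℕ → PointedGraph → ℝ := fun M X => (embTrunc H x M X.graph X.root : ℝ)
  let τ : ℕ → PointedGraph → ℝ := fun M => degFun (tailPart (fun d => (d : ℝ) ^ (h - 1)) M)
  have hTloc : ∀ M, IsLocal (h + 1) (T M) := fun M =>
    (isLocal_embTrunc hH x M).comp (Nat.cast : ℕ → ℝ)
  have hTint : ∀ M n, Integrable (fun ω => vertexAvg (T M) (G n ω)) P := fun M n =>
    integrable_vertexAvg (hG n) (abs_embTrunc_le hH x M)
  have hτint : ∀ M n, Integrable (fun ω => vertexAvg (τ M) (G n ω)) P := fun M n =>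
    integrable_vertexAvg_tailPart (hG n) hφ (htail.1 n) M
  have hupper : ∀ M n ω, ((G n ω).size : ℝ)⁻¹ * (emb H (G n ω).graph : ℝ) ≤
      vertexAvg (T M) (G n ω) + h * vertexAvg (τ M) (G n ω) := fun M n ω =>
    inv_size_mul_emb_le hH x M (G n ω)
  have hlower : ∀ M n ω, vertexAvg (T M) (G n ω) ≤
      ((G n ω).size : ℝ)⁻¹ * (emb H (G n ω).graph : ℝ) := fun M n ω => by
    rw [inv_size_mul_emb H x]
    refine vertexAvg_mono (fun X => ?_) _
    exact Nat.cast_le.mpr (embTrunc_le_embRooted hH x X.locallyFinite M X.root)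
  have hInt : ∀ n, Integrable (fun ω => ((G n ω).size : ℝ)⁻¹ * (emb H (G n ω).graph : ℝ)) P := by
    intro n
    simp only [inv_size_mul_emb H x]
    refine integrable_vertexAvg_of_le (hG n) (fun X => Nat.cast_nonneg _)
      ((hTint 0 n).add ((hτint 0 n).const_mul (h : ℝ))) fun ω => ?_
    rw [← inv_size_mul_emb]
    exact hupper 0 n ω
  -- A bound uniform in `n` passes to the truncated means of the limit graph, and then by monotone
  -- convergence to the full count at its root. This is how integrability in the limit is obtained.
  obtain ⟨B, hB⟩ : ∃ B, ∀ n, ∫ ω, ((G n ω).size : ℝ)⁻¹ * (emb H (G n ω).graph : ℝ) ∂P ≤ B := by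
    obtain ⟨M, hM⟩ := (htail.2 1 one_pos).exists
    refine ⟨(M : ℝ) ^ (h - 1) + h * 1, fun n => ?_⟩
    have h1 := integral_mono (hInt n) ((hTint M n).add ((hτint M n).const_mul (h : ℝ)))
      (hupper M n)
    simp only [Pi.add_apply] at h1
    rw [integral_add (hTint M n) ((hτint M n).const_mul _), integral_const_mul] at h1
    have h2 := integral_mono (hTint M n) (integrable_const ((M : ℝ) ^ (h - 1)))
      fun ω => (abs_le.mp (abs_vertexAvg_le (abs_embTrunc_le hH x M) (G n ω))).2
    rw [integral_const, probReal_univ, one_smul] at h2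
    have h3 := mul_le_mul_of_nonneg_left (hM n) (Nat.cast_nonneg (α := ℝ) h)
    linarith
  have hTB : ∀ M, ∫ ω, T M (Gs ω).pointed ∂P ≤ B := fun M =>
    le_of_tendsto' (tendsto_integral_vertexAvg hG hGs hconv (hTloc M) (abs_embTrunc_le hH x M))
      fun n => (integral_mono (hTint M n) (hInt n) (hlower M n)).trans (hB n)
  have hTm : ∀ M, Measurable fun ω => T M (Gs ω).pointed := fun M =>
    (hTloc M).measurable.comp hGs
  have hTint' : ∀ M, Integrable (fun ω => T M (Gs ω).pointed) P := fun M =>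
    Integrable.of_bound (hTm M).aestronglyMeasurable _ (ae_of_all _ fun ω =>
      abs_embTrunc_le hH x M _)
  have hTlim : ∀ ω, Tendsto (fun M => T M (Gs ω).pointed) atTop
      (𝓝 (embRooted H x (Gs ω).graph (Gs ω).root : ℝ)) := fun ω =>
    tendsto_const_nhds.congr' (by
      filter_upwards [embTrunc_eventually_eq hH x (Gs ω).locallyFinite (Gs ω).root] with D hD
      simp only [T, ← hD]
      rfl)
  have hR : Integrable (fun ω => (embRooted H x (Gs ω).graph (Gs ω).root : ℝ)) P := by
    rw [← lintegral_ofReal_ne_top_iff_integrable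
      (measurable_embRooted hH x hGs).aestronglyMeasurable (ae_of_all _ fun ω => Nat.cast_nonneg _)]
    refine ne_top_of_le_ne_top (ENNReal.ofReal_ne_top (r := B)) ?_
    refine le_of_tendsto' (lintegral_tendsto_of_tendsto_of_monotone
      (f := fun M ω => ENNReal.ofReal (T M (Gs ω).pointed))
      (fun M => (hTm M).ennreal_ofReal.aemeasurable) (ae_of_all _ fun ω M M' hM => ?_)
      (ae_of_all _ fun ω => (ENNReal.continuous_ofReal.tendsto _).comp (hTlim ω))) fun M => ?_
    · exact ENNReal.ofReal_le_ofReal 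
        (Nat.cast_le.mpr (embTrunc_mono hH x (Gs ω).locallyFinite (Gs ω).root hM))
    · rw [← ofReal_integral_eq_lintegral_ofReal (hTint' M)
        (ae_of_all _ fun ω => Nat.cast_nonneg _)]
      exact ENNReal.ofReal_le_ofReal (hTB M)
  refine ⟨hInt, hR, ?_⟩
  have hTconv := tendsto_integral_of_dominated_convergence _
    (fun M => (hTm M).aestronglyMeasurable) hR (fun M => ae_of_all _ fun ω => by
      rw [Real.norm_eq_abs, abs_of_nonneg (Nat.cast_nonneg _)]
      exact Nat.cast_le.mpr (embTrunc_le_embRooted hH x (Gs ω).locallyFinite M (Gs ω).root))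
    (ae_of_all _ hTlim)
  rw [Metric.tendsto_atTop]
  intro ε hε
  -- The tail enters multiplied by `h`, and `h * (ε / (3 * (h + 1))) ≤ ε / 3`; the `+ 1` keeps the
  -- denominator positive.
  have hδ : 0 < ε / (3 * (h + 1)) := by positivity
  obtain ⟨M, hM, hM'⟩ := ((htail.2 _ hδ).and
    (hTconv.eventually (Metric.ball_mem_nhds _ (show 0 < ε / 3 by positivity)))).exists
  obtain ⟨N, hN⟩ := Metric.tendsto_atTop.mp (tendsto_integral_abs_vertexAvg_sub hG hGs hconv
    (hTloc M) (abs_embTrunc_le hH x M)) (ε / 3) (by positivity)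
  refine ⟨N, fun n hn => ?_⟩
  have h1 := hN n hn
  rw [Real.dist_0_eq_abs, abs_of_nonneg (integral_nonneg fun ω => abs_nonneg _)] at h1 ⊢
  set t := ∫ ω, (embRooted H x (Gs ω).graph (Gs ω).root : ℝ) ∂P
  set s := ∫ ω, T M (Gs ω).pointed ∂P
  rw [Real.dist_eq] at hM'
  have hi1 : Integrable (fun ω => |vertexAvg (T M) (G n ω) - s|) P :=
    ((hTint M n).sub (integrable_const s)).abs
  have hi2 : Integrable (fun ω => h * vertexAvg (τ M) (G n ω)) P := (hτint M n).const_mul _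
  have hi12 : Integrable (fun ω => |vertexAvg (T M) (G n ω) - s| +
      h * vertexAvg (τ M) (G n ω)) P := hi1.add hi2
  -- The three terms are the fluctuation of the truncated count, the loss by truncation in `G n`,
  -- and the loss by truncation in the limit.
  have hpt : ∀ ω, |((G n ω).size : ℝ)⁻¹ * (emb H (G n ω).graph : ℝ) - t| ≤
      |vertexAvg (T M) (G n ω) - s| + h * vertexAvg (τ M) (G n ω) + |s - t| := fun ω => by
    have a1 := hupper M n ω
    have a2 := hlower M n ω
    have a3 := abs_le.mp (le_refl |vertexAvg (T M) (G n ω) - s|)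
    have a4 := abs_le.mp (le_refl |s - t|)
    rw [abs_le]
    constructor <;> linarith [a3.1, a3.2, a4.1, a4.2]
  have h2 := integral_mono ((hInt n).sub (integrable_const t)).abs
    (hi12.add (integrable_const |s - t|)) hpt
  simp only [Pi.add_apply, Pi.sub_apply] at h2
  rw [integral_add hi12 (integrable_const _), integral_add hi1 hi2, integral_const_mul,
    integral_const, probReal_univ, one_smul] at h2
  have h3 := mul_le_mul_of_nonneg_left (hM n) (Nat.cast_nonneg (α := ℝ) h)
  have h4 : (h : ℝ) * (ε / (3 * (h + 1))) ≤ ε / 3 := by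
    rw [mul_div_assoc', div_le_div_iff₀ (by positivity) (by positivity)]
    nlinarith
  linarith

/-! ### Embedding counts against small tails -/

theorem SmallTails.meanEmbConverges (hG : ∀ n, Measurable (G n))
    (hGs : Measurable Gs) (hconv : LocallyConvergesInProb P G Gs) {h : ℕ}
    (htail : SmallTails P G fun d => (d : ℝ) ^ (h - 1)) : MeanEmbConverges P G Gs h := by
  intro H x hH
  obtain ⟨hInt, hR, hlim⟩ := htail.tendsto_integral_abs_emb_sub hG hGs hconv hH x
  refine ⟨hInt, hR, ?_⟩
  rw [tendsto_iff_norm_sub_tendsto_zero]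
  refine squeeze_zero (fun n => norm_nonneg _) (fun n => ?_) hlim
  have hsub := integral_sub (hInt n)
    (integrable_const (∫ ω, (embRooted H x (Gs ω).graph (Gs ω).root : ℝ) ∂P))
  rw [integral_const, probReal_univ, one_smul] at hsub
  rw [← hsub]
  exact norm_integral_le_integral_norm _

theorem SmallTails.embConvergesInProb (hG : ∀ n, Measurable (G n))
    (hGs : Measurable Gs) (hconv : LocallyConvergesInProb P G Gs) {h : ℕ}
    (htail : SmallTails P G fun d => (d : ℝ) ^ (h - 1)) : EmbConvergesInProb P G Gs h := by
  intro H x hH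
  obtain ⟨hInt, hR, hlim⟩ := htail.tendsto_integral_abs_emb_sub hG hGs hconv hH x
  refine ⟨hR, tendstoInMeasure_of_tendsto_eLpNorm one_ne_zero
    (fun n => (hInt n).aestronglyMeasurable) aestronglyMeasurable_const ?_⟩
  have := (ENNReal.continuous_ofReal.tendsto 0).comp hlim
  rw [ENNReal.ofReal_zero] at this
  refine this.congr fun n => ?_
  rw [eLpNorm_one_eq_lintegral_enorm]
  refine (ofReal_integral_eq_lintegral_ofReal ((hInt n).sub (integrable_const _)).abs
    (ae_of_all _ fun ω => abs_nonneg _)).trans ?_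
  refine lintegral_congr fun ω => ?_
  rw [← Real.norm_eq_abs, ofReal_norm]

/-- One test graph suffices, the star on `h` vertices rooted at its centre: its rooted count is a
falling factorial of the degree, so the hypothesis is convergence of the mean of a function of the
degree. -/
theorem MeanEmbConverges.smallTails (hG : ∀ n, Measurable (G n))
    (hGs : Measurable Gs) (hconv : LocallyConvergesInProb P G Gs) {h : ℕ} (hh : h ≠ 0)
    (hmean : MeanEmbConverges P G Gs h) : SmallTails P G fun d => (d : ℝ) ^ (h - 1) := by
  obtain ⟨k, rfl⟩ := Nat.exists_eq_succ_of_ne_zero hh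
  obtain ⟨hInt, hR, hlim⟩ := hmean (SimpleGraph.starGraph 0) 0 (SimpleGraph.connected_starGraph 0)
  have hroot : ∀ X : PointedGraph,
      (embRooted (SimpleGraph.starGraph (0 : Fin (k + 1))) 0 X.graph X.root : ℝ) =
        degFun (fun d => (d.descFactorial k : ℝ)) X := fun X => by
    rw [embRooted_starGraph X.locallyFinite]; rfl
  have hroot' : ∀ ω, (embRooted (SimpleGraph.starGraph (0 : Fin (k + 1))) 0 (Gs ω).graph
      (Gs ω).root : ℝ) = degFun (fun d => (d.descFactorial k : ℝ)) (Gs ω).pointed := fun ω =>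
    hroot (Gs ω).pointed
  simp only [Nat.succ_eq_add_one, inv_size_mul_emb _ (0 : Fin (k + 1)), hroot, hroot'] at hInt hR hlim
  exact (smallTails_of_tendsto hG hGs hconv (fun d => Nat.cast_nonneg _) hR hInt
    hlim).pow_of_descFactorial hG

end Moments

end LocalWeak

end

/-! ### The equivalences, all through small tails -/

theorem mainTheorem3 {Ω : Type*} [MeasurableSpace Ω] (P : MeasureTheory.Measure Ω)
    [MeasureTheory.IsProbabilityMeasure P]
    (h : ℕ) (hh : 2 ≤ h)
    (G : ℕ → Ω → LocalWeak.FinGraph) (hG : ∀ n, Measurable (G n))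
    (hsize : ∀ N : ℕ, ∀ᶠ n in Filter.atTop, ∀ᵐ ω ∂P, N ≤ (G n ω).size)
    (v : (n : ℕ) → (ω : Ω) → Fin (G n ω).size)
    (hv : ∀ n, LocalWeak.IsUniformVertex P (G n) (v n))
    (Gs : Ω → LocalWeak.RootedGraph) (hGs : Measurable Gs)
    (hconv : LocalWeak.LocallyConvergesInProb P G Gs)
    (hmoment : MeasureTheory.Integrable
      (fun ω => (LocalWeak.deg (Gs ω).graph (Gs ω).root : ℝ) ^ (h - 1)) P) :
    List.TFAE
      [LocalWeak.DegreeMomentConverges P G v Gs (h - 1),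
        LocalWeak.DegreePowerUniformIntegrable P G v (h - 1),
        LocalWeak.MeanEmbConverges P G Gs h] ∧
    (LocalWeak.DegreeMomentConverges P G v Gs (h - 1) →
      LocalWeak.EmbConvergesInProb P G Gs h) ∧
    (LocalWeak.DegreePowerUniformIntegrable P G v (h - 1) →
      LocalWeak.EmbConvergesInProb P G Gs h) ∧
    (LocalWeak.MeanEmbConverges P G Gs h →
      LocalWeak.EmbConvergesInProb P G Gs h) := by
  have hφ : ∀ d : ℕ, (0 : ℝ) ≤ (d : ℝ) ^ (h - 1) := fun d => by positivity
  have h1 : LocalWeak.DegreeMomentConverges P G v Gs (h - 1) ↔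
      LocalWeak.SmallTails P G fun d => (d : ℝ) ^ (h - 1) := by
    rw [LocalWeak.degreeMomentConverges_iff hG hv]
    exact ⟨fun hm => LocalWeak.smallTails_of_tendsto hG hGs hconv hφ hmoment hm.1 hm.2,
      fun ht => ⟨ht.1, ht.tendsto hG hGs hconv hφ hmoment⟩⟩
  have h2 := LocalWeak.degreePowerUniformIntegrable_iff hG hv (k := h - 1) (by omega)
  have h3 : LocalWeak.MeanEmbConverges P G Gs h ↔
      LocalWeak.SmallTails P G fun d => (d : ℝ) ^ (h - 1) :=
    ⟨fun hm => hm.smallTails hG hGs hconv (by omega),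
      fun ht => ht.meanEmbConverges hG hGs hconv⟩
  have h4 : (LocalWeak.SmallTails P G fun d => (d : ℝ) ^ (h - 1)) →
      LocalWeak.EmbConvergesInProb P G Gs h := fun ht => ht.embConvergesInProb hG hGs hconv
  refine ⟨?_, fun hm => h4 (h1.mp hm), fun hm => h4 (h2.mp hm), fun hm => h4 (h3.mp hm)⟩
  tfae_have 1 ↔ 2 := h1.trans h2.symm
  tfae_have 2 ↔ 3 := h2.trans h3.symm
  tfae_finish
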